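/- Let $n\ge 2$ be even, let $m_1,\dots,m_n\ge 2$ and $m\ge 2$ be integers, let $g(x)=x_1^{m_1}+\dots+x_n^{m_n}$, and let $P\in\mathbb{C}[y]$ have degree $m$ and nonzero discriminant. Put $f=g(x)+P(y)$, $U=\{f=0\}\subset\mathbb{C}^{n+1}$, $m_{n+1}=m$, and let $X$ be a desingularization of the weighted projective hypersurface given by the quasi-homogenization of $f$. For $\beta=(\beta',\beta_{n+1})\in\mathbb{Z}_{\ge0}^{n+1}$ let $A_\beta=\sum_{i=1}^{n+1}\frac{\beta_i+1}{m_i}$ and let $\omega_\beta=x_1^{\beta_1}\cdots x_n^{\beta_n}y^{\beta_{n+1}}\,dx_1\wedge\dots\wedge dx_n\wedge dy$. The space of primitive Hodge cycles of $X$ is $$\mathrm{Hod}_n(X,\mathbb{Q})_0=\frac{\{\delta\in H_n(U,\mathbb{Q}) : \int_\delta \mathrm{res}(\omega_\beta/f^j)=0 \text{ if } A_\beta<j,\ 1\le j\le \frac n2\}}{\{\delta\in H_n(U,\mathbb{Q}) : \int_\delta \mathrm{res}(\omega_\beta/f^j)=0 \text{ if } A_\beta<j,\ 1\le j\le n+1\}}.$$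 Let $J=\prod_{i=1}^n\{0,\dots,m_i-2\}$ and $\zeta_r=e^{2\pi\sqrt{-1}/r}$. For $c\ne0$ and fixed roots $c^{1/m_i}$, let $\delta^{c}_\alpha$ $(\alpha\in J)$ be the cycles $$\delta^{c}_\alpha=\sum_{a\in\{0,1\}^n}(-1)^{\sum_i(1-a_i)}\Delta_{\alpha+a},\qquad \Delta_{\alpha+a}(t)=\left(c^{1/m_i}\,t_i^{1/m_i}\,\zeta_{m_i}^{\alpha_i+a_i}\right)_{i=1}^n,\quad t_i\ge 0,\ \sum_i t_i=1,$$ which form a basis of $H_{n-1}(\{g=c\},\mathbb{Z})$. Let $b\neq 0$ be a regular value of $P$ and let $\delta_0,\dots,\delta_{m-2}$ be a basis of the reduced homology $\widetilde H_0(P^{-1}(b),\mathbb{Z})$ consisting of vanishing cycles, $\delta_k$ being a difference of two points of the fibre that merge along a path from $b$ to a critical value of $P$. Fix a path from $b$ to $0$. Except at their end points, these paths avoid $0$ and the critical values of $P$. Let $t^{(k)}_s$, $s\in[0,1]$, be the resulting path from the critical value through $b$ to $0$. Let $\delta_k*\delta_\alpha\in H_n(U,\mathbb{Q})$ be the joint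 cycle $\bigcup_{s}\delta_{k,t^{(k)}_s}\times\delta_\alpha^{-t^{(k)}_s}$, obtained by transporting $\delta_k$ and $\delta_\alpha^{-b}$ along this path. Let $$\mathcal{A}=\Big\{(n_{\alpha,k})\in\mathbb{Q}^{J\times\{0,\dots,m-2\}} : \sum_{\alpha\in J}n_{\alpha,k}\int_{\delta_\alpha^{-1}}\mathrm{res}\Big(\frac{x^{\beta'}dx_1\wedge\dots\wedge dx_n}{g+1}\Big)=0\ \text{ for all } k \text{ and all } \beta \text{ with } A_\beta<\tfrac n2\Big\}.$$ The space of strong generic Hodge cycles $\mathrm{SHod}_n(X,\mathbb{Q})_0$ is the image of $\mathcal{A}$ under the natural map $(n_{\alpha,k})\mapsto\big[\sum_{k,\alpha} n_{\alpha,k}\,\delta_k*\delta_\alpha\big]\in \mathrm{Hod}_n(X,\mathbb{Q})_0$. Let $\varphi$ be Euler's totient function. (i) If $m_1=\dots=m_{n-1}=2$ and $3\le m\le 6$, then $$\dim \mathrm{SHod}_n(X,\mathbb{Q})_0\le (m-1)\sum_{\substack{d\mid m_n\\ 2\le d\le \lfloor 2m/(m-2)\rfloor}}\varphi(d).$$ If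 $m_1=\dots=m_{n-1}=2$ and $m=2$, the same bound holds with the sum taken over all $d\mid m_n$ with $2\le d\le m_n$; hence $\dim \mathrm{SHod}_n(X,\mathbb{Q})_0\le m_n-1$. (ii) If $m_1=\dots=m_{n-2}=2$, $m_{n-1}$ is prime, $\gcd(m_{n-1},m_n)=1$ and $\frac1{m_{n-1}}+\frac1m\ge\frac12$, then $$\dim \mathrm{SHod}_n(X,\mathbb{Q})_0\le (m-1)(m_{n-1}-1)\sum_{\substack{d\mid m_n\\ 2\le d\le \left\lfloor \frac{m\,m_{n-1}}{m\,m_{n-1}-m-m_{n-1}}\right\rfloor}}\varphi(d),$$ where for $m=m_{n-1}=2$ (zero denominator) the sum is taken over all $d\mid m_n$ with $2\le d\le m_n$. -/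

import Mathlib

open CategoryTheory

noncomputable section

namespace HodgeJoin

/-! ## Residues of polynomial forms with poles along a hypersurface

A polynomial `(N-1)`-form on `ℂ^N` is written as the contraction `ι_R dx` of the volume form
`dx = dx_1 ∧ ⋯ ∧ dx_N` with a polynomial vector field `R`.  With this notation
`dh ∧ ι_R dx = (∑ i, R_i ∂_i h) dx` and `d (ι_Ξ dx) = (∑ i, ∂_i Ξ_i) dx`. -/

/-- The affine hypersurface `{h = 0}` in `ℂ^N`. -/
def zeroLocus {N : ℕ} (h : MvPolynomial (Fin N) ℂ) : Set (Fin N → ℂ) :=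
  {z | MvPolynomial.eval z h = 0}

/-- The monomial `x^β`. -/
def mono {N : ℕ} (β : Fin N → ℕ) : MvPolynomial (Fin N) ℂ :=
  ∏ i, MvPolynomial.X i ^ β i

/-- The form `ι_R dx`, restricted to `{h = 0}`, represents the residue of `w dx / h ^ j`
(for `1 ≤ j`): there is a polynomial vector field `Ξ` with
`w dx / h ^ j = (dh / h) ∧ ι_R dx + d (ι_Ξ dx / h ^ (j - 1))`.
The identity below is this one multiplied by `h ^ j`. -/
def IsResidue {N : ℕ} (h w : MvPolynomial (Fin N) ℂ) (j : ℕ)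
    (R : Fin N → MvPolynomial (Fin N) ℂ) : Prop :=
  ∃ Ξ : Fin N → MvPolynomial (Fin N) ℂ,
    w = (∑ i, R i * MvPolynomial.pderiv i h) * h ^ (j - 1)
      + h * (∑ i, MvPolynomial.pderiv i (Ξ i))
      - ((j - 1 : ℕ) : MvPolynomial (Fin N) ℂ) * ∑ i, Ξ i * MvPolynomial.pderiv i h

/-! ## Integration over singular simplices -/

/-- The domain of the coordinates `(t_1, …, t_k)` of the standard `k`-simplex. -/
def simplexDomain (k : ℕ) : Set (Fin k → ℝ) :=
  {t | (∀ i, 0 ≤ t i) ∧ ∑ i, t i ≤ 1}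

/-- The point `(1 - ∑ t_i, t_1, …, t_k)` of the standard simplex. -/
def simplexPoint {k : ℕ} (t : Fin k → ℝ) (ht : t ∈ simplexDomain k) :
    stdSimplex ℝ (Fin (k + 1)) :=
  ⟨Fin.cons (1 - ∑ i, t i) t, by
    refine ⟨fun i => ?_, ?_⟩
    · refine Fin.cases ?_ (fun i => ?_) i
      · simpa using ht.2
      · simpa using ht.1 i
    · simp [Fin.sum_univ_succ]⟩

open Classical in
/-- A map on the standard `k`-simplex in the coordinates `(t_1, …, t_k)`, extended by zero. -/
def inCoordinates {k N : ℕ} (σ : stdSimplex ℝ (Fin (k + 1)) → (Fin N → ℂ)) :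
    (Fin k → ℝ) → (Fin N → ℂ) :=
  fun t => if ht : t ∈ simplexDomain k then σ (simplexPoint t ht) else 0

/-- The integral `∫_σ ι_R dx` of the `k`-form `ι_R dx` on `ℂ^(k+1)` over
`σ : Δ^k → ℂ^(k+1)`; the integrand is `dx (R, ∂σ/∂t_1, …, ∂σ/∂t_k)`. -/
def simplexIntegral {k : ℕ} (R : Fin (k + 1) → MvPolynomial (Fin (k + 1)) ℂ)
    (σ : stdSimplex ℝ (Fin (k + 1)) → (Fin (k + 1) → ℂ)) : ℂ :=
  ∫ t in simplexDomain k, Matrix.det (Matrix.of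
    (Fin.cons (fun j => MvPolynomial.eval (inCoordinates σ t) (R j))
      (fun i : Fin k =>
        fderivWithin ℝ (inCoordinates σ) (simplexDomain k) t (Pi.single i 1)) :
      Fin (k + 1) → Fin (k + 1) → ℂ))

/-- A simplex in `ℂ^N` is smooth if it is `C^∞` up to the boundary. -/
def IsSmoothSimplex {k N : ℕ} (σ : stdSimplex ℝ (Fin (k + 1)) → (Fin N → ℂ)) : Prop :=
  ContDiffOn ℝ (⊤ : ℕ∞) (inCoordinates σ) (simplexDomain k)

/-! ## Singular homology with rational coefficients -/

/-- The singular chain complex of `X` with coefficients in `ℚ`. -/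
abbrev singularChains (X : TopCat.{0}) : ChainComplex (ModuleCat.{0} ℚ) ℕ :=
  ((AlgebraicTopology.singularChainComplexFunctor (ModuleCat.{0} ℚ)).obj
    (ModuleCat.of ℚ ℚ)).obj X

/-- The singular homology `H_k(X, ℚ)`. -/
abbrev singularHomology (X : TopCat.{0}) (k : ℕ) : ModuleCat.{0} ℚ :=
  ((AlgebraicTopology.singularHomologyFunctor (ModuleCat.{0} ℚ) k).obj
    (ModuleCat.of ℚ ℚ)).obj X

/-- The inclusion of the summand of the singular chains corresponding to a singular simplex. -/
def simplexInclusion {X : TopCat.{0}} {k : ℕ} (σ : C(stdSimplex ℝ (Fin (k + 1)), X)) :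
    ModuleCat.of ℚ ℚ ⟶ (singularChains X).X k :=
  (TopCat.toSSet.obj X).ιChainComplex ((X.toSSetObjEquiv (.op (SimplexCategory.mk k))).symm σ)

/-- A singular simplex, as a singular chain. -/
def simplexChain {X : TopCat.{0}} {k : ℕ} (σ : C(stdSimplex ℝ (Fin (k + 1)), X)) :
    (singularChains X).X k :=
  (simplexInclusion σ).hom (1 : ℚ)

section Hypersurface

variable {k : ℕ} (h : MvPolynomial (Fin (k + 1)) ℂ)

/-- The hypersurface `{h = 0}` as a topological space. -/
def hypersurface : TopCat.{0} := TopCat.of (zeroLocus h)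

/-- A singular simplex of the hypersurface, as a map to the ambient affine space. -/
def ambient (σ : C(stdSimplex ℝ (Fin (k + 1)), hypersurface h)) :
    stdSimplex ℝ (Fin (k + 1)) → (Fin (k + 1) → ℂ) :=
  fun u => (show zeroLocus h from σ u).1

/-- The smooth singular `k`-chains of the hypersurface. -/
def smoothChains : Submodule ℚ ((singularChains (hypersurface h)).X k) :=
  Submodule.span ℚ {c | ∃ σ : C(stdSimplex ℝ (Fin (k + 1)), hypersurface h),
    IsSmoothSimplex (ambient h σ) ∧ c = simplexChain σ}

/-- Integration of `ι_R dx` over singular `k`-chains: the linear extension of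
`simplexIntegral` (used on smooth chains only). -/
def chainIntegral (R : Fin (k + 1) → MvPolynomial (Fin (k + 1)) ℂ) :
    (singularChains (hypersurface h)).X k →ₗ[ℚ] ℂ :=
  (Limits.Cofan.IsColimit.desc
    ((TopCat.toSSet.obj (hypersurface h)).isColimitChainComplexXCofan (ModuleCat.of ℚ ℚ) k)
    (fun x => (ModuleCat.ofHom (LinearMap.toSpanSingleton ℚ ℂ
      (simplexIntegral R (ambient h ((hypersurface h).toSSetObjEquiv (.op (SimplexCategory.mk k)) x)))) :
        ModuleCat.of ℚ ℚ ⟶ ModuleCat.of ℚ ℂ))).hom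

/-- The homology classes `δ ∈ H_k({h = 0}, ℚ)` with `∫_δ res (w dx / h ^ j) = 0` for all pairs
`(w, j)` in a given set.  The integral over a class is computed on a smooth cycle
representing it. -/
def periodKernel (S : Set (MvPolynomial (Fin (k + 1)) ℂ × ℕ)) :
    Submodule ℚ (singularHomology (hypersurface h) k) :=
  Submodule.map ((singularChains (hypersurface h)).homologyπ k).hom
    (Submodule.comap ((singularChains (hypersurface h)).iCycles k).hom
      (smoothChains h ⊓
        ⨅ p ∈ S, ⨅ R : {R : Fin (k + 1) → MvPolynomial (Fin (k + 1)) ℂ //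
          IsResidue h p.1 p.2 R}, LinearMap.ker (chainIntegral h R.1)))

end Hypersurface

/-! ## The affine variety `f = x_1 ^ m_1 + ⋯ + x_n ^ m_n + P(y)` and its Hodge cycles

Throughout `n = k + 1`, the exponents are `M : Fin (k + 1) → ℕ`, and the coordinates of
`ℂ^(n+1)` are `(x_1, …, x_n, y)`. -/

section Variety

variable {k : ℕ} (M : Fin (k + 1) → ℕ)

/-- `g = x_1 ^ m_1 + ⋯ + x_n ^ m_n`. -/
def fermat : MvPolynomial (Fin (k + 1)) ℂ := ∑ i, MvPolynomial.X i ^ M i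

/-- `f = x_1 ^ m_1 + ⋯ + x_n ^ m_n + P(y)`. -/
def affinePoly (P : Polynomial ℂ) : MvPolynomial (Fin (k + 2)) ℂ :=
  ∑ i : Fin (k + 1), MvPolynomial.X i.castSucc ^ M i
    + Polynomial.aeval (MvPolynomial.X (Fin.last (k + 1))) P

/-- `A_β = ∑_{i ≤ n} (β_i + 1) / m_i + (β_{n+1} + 1) / m`. -/
def weight (m : ℕ) (β : Fin (k + 2) → ℕ) : ℚ :=
  ∑ i : Fin (k + 1), ((β i.castSucc : ℚ) + 1) / M i + ((β (Fin.last (k + 1)) : ℚ) + 1) / m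

/-- `H_n(U, ℚ)` for `U = {f = 0}`. -/
abbrev affineHomology (P : Polynomial ℂ) : ModuleCat.{0} ℚ :=
  singularHomology (hypersurface (affinePoly M P)) (k + 1)

/-- The classes `δ ∈ H_n(U, ℚ)` with `∫_δ res (x^β dx / f ^ j) = 0` whenever
`A_β < j` and `1 ≤ j ≤ q`. -/
def orthogonalClasses (P : Polynomial ℂ) (q : ℕ) : Submodule ℚ (affineHomology M P) :=
  periodKernel (affinePoly M P)
    {p | ∃ β : Fin (k + 2) → ℕ, p.1 = mono β ∧ weight M P.natDegree β < p.2 ∧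
      1 ≤ p.2 ∧ p.2 ≤ q}

/-- The primitive homology `H_n(X, ℚ)_0` of a desingularization `X`: the quotient of `H_n(U, ℚ)`
by the classes on which all `res (x^β dx / f ^ j)`, `A_β < j`, `1 ≤ j ≤ n + 1`, have zero
period. -/
abbrev PrimitiveHomology (P : Polynomial ℂ) : Type :=
  affineHomology M P ⧸ orthogonalClasses M P (k + 2)

/-- The primitive Hodge cycles `Hod_n(X, ℚ)_0`, as a subspace of the primitive homology: the
quotient of the classes orthogonal to `res (x^β dx / f ^ j)`, `A_β < j`, `1 ≤ j ≤ n / 2`, by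
those orthogonal to the forms with `1 ≤ j ≤ n + 1`. -/
def Hod (P : Polynomial ℂ) : Submodule ℚ (PrimitiveHomology M P) :=
  (orthogonalClasses M P ((k + 1) / 2)).map (orthogonalClasses M P (k + 2)).mkQ

end Variety

/-! ## Cycles on the Fermat variety -/

/-- The index set `J = ∏ {0, …, m_i - 2}`. -/
abbrev IndexJ {k : ℕ} (M : Fin (k + 1) → ℕ) : Type := (i : Fin (k + 1)) → Fin (M i - 1)

/-- The exponents `α + a`, for `a ∈ {0, 1}^n`. -/
def shift {k : ℕ} {M : Fin (k + 1) → ℕ} (α : IndexJ M) (a : Fin (k + 1) → Fin 2) :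
    Fin (k + 1) → ℕ :=
  fun i => (α i : ℕ) + (a i : ℕ)

/-- The sign `(-1) ^ ∑ (1 - a_i)`. -/
def cornerSign {k : ℕ} (a : Fin (k + 1) → Fin 2) : ℤ := (-1) ^ (∑ i, (1 - (a i : ℕ)))

/-- `ζ_m = exp (2 π i / m)`. -/
def zetaRoot (m : ℕ) : ℂ := Complex.exp (2 * Real.pi * Complex.I / m)

/-- The simplex `t ↦ (t_i ^ (1 / m_i) ζ_{m_i} ^ (e_i) ρ_i)_i` of `{g = c}`, where
`ρ_i` is a chosen `m_i`-th root of `c`. -/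
def phamSimplex {k : ℕ} (M : Fin (k + 1) → ℕ) (ρ : Fin (k + 1) → ℂ) (e : Fin (k + 1) → ℕ)
    (t : stdSimplex ℝ (Fin (k + 1))) : Fin (k + 1) → ℂ :=
  fun i => (((t i) ^ (1 / (M i : ℝ)) : ℝ) : ℂ) * zetaRoot (M i) ^ e i * ρ i

/-- The `m_i`-th roots `exp (π i / m_i)` of `-1`. -/
def rootsNegOne {k : ℕ} (M : Fin (k + 1) → ℕ) (i : Fin (k + 1)) : ℂ :=
  Complex.exp (Real.pi * Complex.I / M i)

/-- The integral of `ι_R dx'` over the cycle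
`δ_α^{-1} = ∑_a (-1) ^ (∑ (1 - a_i)) Δ_{α + a}` of `{g = -1}`. -/
def fermatPeriod {k : ℕ} (M : Fin (k + 1) → ℕ)
    (R : Fin (k + 1) → MvPolynomial (Fin (k + 1)) ℂ) (α : IndexJ M) : ℂ :=
  ∑ a : Fin (k + 1) → Fin 2,
    (cornerSign a : ℂ) * simplexIntegral R (phamSimplex M (rootsNegOne M) (shift α a))

/-- The space `𝒜` of the rational vectors `(n_{α,l})`, `α ∈ J`, `0 ≤ l ≤ m - 2`, such that
`∑_α n_{α,l} ∫_{δ_α^{-1}} res (x^{β'} dx' / (g + 1)) = 0` for all `l` and all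
`β = (β', β_{n+1})` with `A_β < n / 2`. -/
def spaceA {k : ℕ} (M : Fin (k + 1) → ℕ) (m : ℕ) :
    Submodule ℚ (IndexJ M × Fin (m - 1) → ℚ) where
  carrier := {ν | ∀ β : Fin (k + 2) → ℕ, weight M m β < ((k + 1 : ℕ) : ℚ) / 2 →
    ∀ R : Fin (k + 1) → MvPolynomial (Fin (k + 1)) ℂ,
      IsResidue (fermat M + 1) (mono fun i => β i.castSucc) 1 R →
        ∀ l : Fin (m - 1), ∑ α : IndexJ M, (ν (α, l) : ℂ) * fermatPeriod M R α = 0}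
  zero_mem' := by
    intro β _ R _ l
    simp
  add_mem' := by
    intro ν ν' hν hν' β hβ R hR l
    have h1 := hν β hβ R hR l
    have h2 := hν' β hβ R hR l
    simp only [Pi.add_apply, Rat.cast_add, add_mul, Finset.sum_add_distrib, h1, h2, add_zero]
  smul_mem' := by
    intro c ν hν β hβ R hR l
    have h1 := hν β hβ R hR l
    simp only [Pi.smul_apply, smul_eq_mul, Rat.cast_mul, mul_assoc, ← Finset.mul_sum, h1,
      mul_zero]

/-! ## Vanishing cycles and joint cycles -/

/-- The critical values of `P`. -/
def criticalValues (P : Polynomial ℂ) : Set ℂ :=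
  {c | ∃ z, P.derivative.eval z = 0 ∧ P.eval z = c}

/-- The reduced zero-dimensional homology with integral coefficients of a finite (discrete) set
`S ⊆ ℂ`: the zero-cycles on `S` of degree zero. -/
def reducedZeroCycles (S : Set ℂ) : Submodule ℤ (ℂ →₀ ℤ) :=
  Finsupp.supported ℤ ℤ S ⊓ LinearMap.ker (Finsupp.linearCombination ℤ fun _ : ℂ => (1 : ℤ))

/-- The midpoint of the unit interval. -/
def half : unitInterval := ⟨1 / 2, by norm_num, by norm_num⟩

/-- The choices that enter the construction of the joint cycles `δ_l * δ_α`, `0 ≤ l ≤ m - 2`: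
a regular value `b ≠ 0` of `P`; paths `τ_l` from critical values of `P` through `b` (at time
`1/2`) to `0`, avoiding `0` and the critical values in between and following a common path from
`b` to `0`; vanishing cycles `δ_l = [y_l^1] - [y_l^0]` in the fibres of `P` along `τ_l`, which
form a basis of the reduced homology of `P⁻¹(b)`; and branches along `τ_l` of the `m_i`-th roots
of `-τ_l`, which determine the cycles `δ_α` of the varieties `{g = -τ_l(s)}`. -/
structure JointSystem {k : ℕ} (M : Fin (k + 1) → ℕ) (P : Polynomial ℂ) where
  b : ℂ
  b_ne_zero : b ≠ 0
  b_regular : b ∉ criticalValues P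
  τ : Fin (P.natDegree - 1) → C(unitInterval, ℂ)
  τ_zero : ∀ l, τ l 0 ∈ criticalValues P
  τ_half : ∀ l, τ l half = b
  τ_one : ∀ l, τ l 1 = 0
  τ_avoids : ∀ l s, 0 < s → s < 1 → τ l s ≠ 0 ∧ τ l s ∉ criticalValues P
  τ_common : ∀ l l' s, half ≤ s → τ l s = τ l' s
  y : Fin (P.natDegree - 1) → Fin 2 → C(unitInterval, ℂ)
  y_lift : ∀ l ε s, P.eval (y l ε s) = τ l s
  y_merge : ∀ l, y l 0 0 = y l 1 0
  y_ne : ∀ l s, 0 < s → y l 0 s ≠ y l 1 s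
  basis_linearIndependent : LinearIndependent ℤ
    (fun l => Finsupp.single (y l 1 half) (1 : ℤ) - Finsupp.single (y l 0 half) (1 : ℤ))
  basis_span : Submodule.span ℤ (Set.range
    (fun l => Finsupp.single (y l 1 half) (1 : ℤ) - Finsupp.single (y l 0 half) (1 : ℤ)))
      = reducedZeroCycles {z | P.eval z = b}
  ρ : Fin (P.natDegree - 1) → Fin (k + 1) → C(unitInterval, ℂ)
  ρ_pow : ∀ l i s, ρ l i s ^ M i = -τ l s
  ρ_common : ∀ l l' i, ρ l i half = ρ l' i half

section Joint

variable {k : ℕ} {M : Fin (k + 1) → ℕ} {P : Polynomial ℂ}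

/-- A coordinate of a point of the simplex, as an element of the unit interval. -/
def coord {N : ℕ} (u : stdSimplex ℝ (Fin N)) (i : Fin N) : unitInterval :=
  ⟨u i, stdSimplex.zero_le u i, stdSimplex.le_one u i⟩

lemma continuous_coord {N : ℕ} (i : Fin N) :
    Continuous fun u : stdSimplex ℝ (Fin N) => coord u i :=
  Continuous.subtype_mk ((continuous_apply i).comp continuous_subtype_val) _

lemma zetaRoot_pow {m : ℕ} (hm : 2 ≤ m) (e : ℕ) : (zetaRoot m ^ e) ^ m = 1 := by
  have : zetaRoot m ^ m = 1 := by
    have h0 : (m : ℂ) ≠ 0 := by exact_mod_cast (by omega : m ≠ 0)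
    rw [zetaRoot, ← Complex.exp_nat_mul, mul_div_cancel₀ _ h0, Complex.exp_two_pi_mul_I]
  rw [← pow_mul, mul_comm, pow_mul, this, one_pow]

/-- The point of `U` over `u = (s, u_1, …, u_n) ∈ Δ^n`: its `x`-part is the point with
coordinates `t = (u_1, …, u_n) / (1 - s)` of the simplex with exponents `e` of
`{g = -τ_l(s)}`, and its `y`-part is `y_l^ε(s)`. -/
def jointPoint (D : JointSystem M P) (l : Fin (P.natDegree - 1)) (ε : Fin 2)
    (e : Fin (k + 1) → ℕ) (u : stdSimplex ℝ (Fin (k + 2))) : Fin (k + 2) → ℂ :=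
  Fin.snoc (α := fun _ => ℂ)
    (fun i : Fin (k + 1) =>
      (((u i.succ / (1 - u 0)) ^ (1 / (M i : ℝ)) : ℝ) : ℂ) * zetaRoot (M i) ^ e i
        * D.ρ l i (coord u 0))
    (D.y l ε (coord u 0))

lemma ratio_mem (u : stdSimplex ℝ (Fin (k + 2))) (i : Fin (k + 1)) :
    0 ≤ u i.succ / (1 - u 0) ∧ u i.succ / (1 - u 0) ≤ 1 := by
  have h0 := stdSimplex.le_one u 0
  have h1 : 0 ≤ u i.succ := stdSimplex.zero_le u i.succ
  refine ⟨div_nonneg h1 (by linarith), div_le_one_of_le₀ ?_ (by linarith)⟩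
  have hs := stdSimplex.sum_eq_one u
  rw [Fin.sum_univ_succ] at hs
  have := Finset.single_le_sum (f := fun i : Fin (k + 1) => u i.succ)
    (fun i _ => stdSimplex.zero_le u i.succ) (Finset.mem_univ i)
  linarith

lemma jointPoint_mem (hM : ∀ i, 2 ≤ M i) (D : JointSystem M P) (l : Fin (P.natDegree - 1))
    (ε : Fin 2) (e : Fin (k + 1) → ℕ) (u : stdSimplex ℝ (Fin (k + 2))) :
    jointPoint D l ε e u ∈ zeroLocus (affinePoly M P) := by
  have hP : MvPolynomial.eval (jointPoint D l ε e u)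
      (Polynomial.aeval (MvPolynomial.X (Fin.last (k + 1))) P)
      = D.τ l (coord u 0) := by
    rw [← D.y_lift l ε, Polynomial.aeval_def, Polynomial.hom_eval₂]
    simp only [MvPolynomial.eval_X, jointPoint, Fin.snoc_last]
    rw [Polynomial.eval]
    congr 1
    ext z
    simp [MvPolynomial.algebraMap_eq]
  have hx : ∀ i : Fin (k + 1), (jointPoint D l ε e u i.castSucc) ^ M i
      = ((u i.succ / (1 - u 0) : ℝ) : ℂ) * (-D.τ l (coord u 0)) := by
    intro i
    have hi := ratio_mem u i
    simp only [jointPoint, Fin.snoc_castSucc]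
    rw [mul_pow, mul_pow, zetaRoot_pow (hM i), mul_one, D.ρ_pow, ← Complex.ofReal_pow,
      ← Real.rpow_natCast, ← Real.rpow_mul hi.1, one_div_mul_cancel, Real.rpow_one]
    exact_mod_cast (by have := hM i; omega : M i ≠ 0)
  simp only [zeroLocus, Set.mem_ofPred_eq, affinePoly, map_add, map_sum, map_pow,
    MvPolynomial.eval_X, hP, hx]
  rw [← Finset.sum_mul, ← Complex.ofReal_sum, ← Finset.sum_div]
  have hs := stdSimplex.sum_eq_one u
  rw [Fin.sum_univ_succ] at hs
  by_cases h1 : u 0 = 1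
  · have : coord u 0 = 1 := Subtype.ext h1
    rw [this, D.τ_one]; simp
  · have h2 : (1 : ℝ) - u 0 ≠ 0 := fun h => h1 (by linarith)
    have h3 : ∑ i : Fin (k + 1), u i.succ = 1 - u 0 := by linarith
    rw [h3, div_self h2]; simp

lemma continuous_jointPoint (hM : ∀ i, 2 ≤ M i) (D : JointSystem M P)
    (l : Fin (P.natDegree - 1)) (ε : Fin 2) (e : Fin (k + 1) → ℕ) :
    Continuous (jointPoint D l ε e) := by
  have happ : ∀ i : Fin (k + 2), Continuous fun u : stdSimplex ℝ (Fin (k + 2)) => u i :=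
    fun i => (continuous_apply i).comp continuous_subtype_val
  refine continuous_pi fun i => ?_
  refine Fin.lastCases ?_ (fun i => ?_) i
  · simp only [jointPoint, Fin.snoc_last]
    exact (D.y l ε).continuous.comp (continuous_coord 0)
  · simp only [jointPoint, Fin.snoc_castSucc]
    have hρ : Continuous fun u : stdSimplex ℝ (Fin (k + 2)) => D.ρ l i (coord u 0) :=
      (D.ρ l i).continuous.comp (continuous_coord 0)
    rw [continuous_iff_continuousAt]
    intro u
    by_cases h1 : u 0 = 1
    · have hz : D.ρ l i (coord u 0) = 0 := by
        have hc : coord u 0 = 1 := Subtype.ext h1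
        have := D.ρ_pow l i (coord u 0)
        rw [hc, D.τ_one, neg_zero] at this
        rw [hc]
        exact pow_eq_zero_iff (by have := hM i; omega) |>.1 this
      have hz' : Filter.Tendsto (fun u : stdSimplex ℝ (Fin (k + 2)) => D.ρ l i (coord u 0))
          (nhds u) (nhds 0) := by
        have := hρ.tendsto u
        rwa [hz] at this
      rw [ContinuousAt, hz, mul_zero]
      refine squeeze_zero_norm (a := fun u => ‖zetaRoot (M i) ^ e i‖ * ‖D.ρ l i (coord u 0)‖)
        (fun v => ?_) ?_
      · rw [norm_mul, norm_mul, Complex.norm_real, Real.norm_eq_abs]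
        have hv := ratio_mem v i
        have h2 : |(v i.succ / (1 - v 0)) ^ (1 / (M i : ℝ))| ≤ 1 := by
          rw [abs_of_nonneg (Real.rpow_nonneg hv.1 _)]
          exact Real.rpow_le_one hv.1 hv.2 (by positivity)
        have := mul_le_mul_of_nonneg_right h2 (norm_nonneg (zetaRoot (M i) ^ e i))
        rw [one_mul] at this
        exact mul_le_mul_of_nonneg_right this (norm_nonneg _)
      · have := (hz'.norm).const_mul ‖zetaRoot (M i) ^ e i‖
        simpa using this
    · have h2 : (1 : ℝ) - u 0 ≠ 0 := fun h => h1 (by linarith)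
      have hd : ContinuousAt
          (fun v : stdSimplex ℝ (Fin (k + 2)) => v i.succ / (1 - v 0)) u :=
        (happ i.succ).continuousAt.div (continuous_const.sub (happ 0)).continuousAt h2
      have hr : ContinuousAt (fun v : stdSimplex ℝ (Fin (k + 2)) =>
          (v i.succ / (1 - v 0)) ^ (1 / (M i : ℝ))) u :=
        hd.rpow_const (Or.inr (by positivity))
      exact ((Complex.continuous_ofReal.continuousAt.comp hr).mul
        continuousAt_const).mul hρ.continuousAt

/-- The singular simplex of `U` given by `jointPoint`. -/
def jointSimplex (hM : ∀ i, 2 ≤ M i) (D : JointSystem M P) (l : Fin (P.natDegree - 1))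
    (ε : Fin 2) (e : Fin (k + 1) → ℕ) :
    C(stdSimplex ℝ (Fin (k + 1 + 1)), hypersurface (affinePoly M P)) where
  toFun u := (⟨jointPoint D l ε e u, jointPoint_mem hM D l ε e u⟩ : zeroLocus (affinePoly M P))
  continuous_toFun := (continuous_jointPoint hM D l ε e).subtype_mk _

/-- The chain `⋃_s δ_l(s) × δ_α(s)`, where `δ_l(s) = [y_l^1(s)] - [y_l^0(s)]` and
`δ_α(s) = ∑_a (-1) ^ (∑ (1 - a_i)) Δ_{α + a}(s)`, as a map sending `1` to a singular chain. -/
def jointChain (hM : ∀ i, 2 ≤ M i) (D : JointSystem M P) (l : Fin (P.natDegree - 1))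
    (α : IndexJ M) :
    ModuleCat.of ℚ ℚ ⟶ (singularChains (hypersurface (affinePoly M P))).X (k + 1) :=
  ∑ a : Fin (k + 1) → Fin 2, cornerSign a •
    (simplexInclusion (jointSimplex hM D l 1 (shift α a))
      - simplexInclusion (jointSimplex hM D l 0 (shift α a)))

/-- The face of a singular simplex opposite to the vertex `i`. -/
def face {X : TopCat.{0}} {N : ℕ} (i : Fin (N + 2)) (σ : C(stdSimplex ℝ (Fin (N + 2)), X)) :
    C(stdSimplex ℝ (Fin (N + 1)), X) :=
  σ.comp ⟨stdSimplex.map i.succAbove, stdSimplex.continuous_map _⟩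

lemma simplexInclusion_d {X : TopCat.{0}} {N : ℕ} (σ : C(stdSimplex ℝ (Fin (N + 2)), X)) :
    simplexInclusion (k := N + 1) σ ≫ (singularChains X).d (N + 1) N
      = ∑ i : Fin (N + 2), (-1 : ℤ) ^ (i : ℕ) • simplexInclusion (face i σ) :=
  (TopCat.toSSet.obj X).ιChainComplex_d (ModuleCat.of ℚ ℚ)
    ((X.toSSetObjEquiv (.op (SimplexCategory.mk (N + 1)))).symm σ)

lemma map_succAbove_self {N : ℕ} (i : Fin (N + 2)) (u : stdSimplex ℝ (Fin (N + 1))) :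
    (stdSimplex.map i.succAbove u) i = 0 := by
  rw [stdSimplex.map_coe, FunOnFinite.linearMap_apply_apply]
  apply Finset.sum_eq_zero
  intro j hj
  simp at hj

/-- Change the value of `a ∈ {0, 1}^n` in the position `p`. -/
def flip (p : Fin (k + 1)) (a : Fin (k + 1) → Fin 2) : Fin (k + 1) → Fin 2 :=
  Function.update a p (1 - a p)

lemma flip_flip (p : Fin (k + 1)) (a : Fin (k + 1) → Fin 2) : flip p (flip p a) = a := by
  simp [flip]

lemma flip_ne (p : Fin (k + 1)) (a : Fin (k + 1) → Fin 2) : flip p a ≠ a := by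
  intro h
  have := congrFun h p
  simp only [flip, Function.update_self] at this
  revert this
  generalize a p = x
  revert x
  decide

lemma cornerSign_flip (p : Fin (k + 1)) (a : Fin (k + 1) → Fin 2) :
    cornerSign (flip p a) = -cornerSign a := by
  have key : ∀ x : Fin 2, (-1 : ℤ) ^ (1 - ((1 - x : Fin 2) : ℕ)) = -(-1) ^ (1 - (x : ℕ)) := by
    decide
  simp only [cornerSign, ← Finset.prod_pow_eq_pow_sum]
  rw [← Finset.mul_prod_erase _ _ (Finset.mem_univ p),
    ← Finset.mul_prod_erase (a := p) _ (fun i => (-1 : ℤ) ^ (1 - (a i : ℕ))) (Finset.mem_univ p),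
    ← neg_mul]
  congr 1
  · simp only [flip, Function.update_self]
    exact key _
  · refine Finset.prod_congr rfl fun i hi => ?_
    rw [flip, Function.update_of_ne (Finset.ne_of_mem_erase hi)]

lemma face_zero_jointSimplex (hM : ∀ i, 2 ≤ M i) (D : JointSystem M P)
    (l : Fin (P.natDegree - 1)) (e : Fin (k + 1) → ℕ) :
    face 0 (jointSimplex hM D l 1 e) = face 0 (jointSimplex hM D l 0 e) := by
  ext u
  refine Subtype.ext ?_
  change jointPoint D l 1 e (stdSimplex.map (Fin.succAbove 0) u)
    = jointPoint D l 0 e (stdSimplex.map (Fin.succAbove 0) u)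
  have : coord (stdSimplex.map (Fin.succAbove 0) u) 0 = 0 :=
    Subtype.ext (map_succAbove_self 0 u)
  simp only [jointPoint, this, D.y_merge l]

lemma face_succ_jointSimplex (hM : ∀ i, 2 ≤ M i) (D : JointSystem M P)
    (l : Fin (P.natDegree - 1)) (ε : Fin 2) (α : IndexJ M) (a : Fin (k + 1) → Fin 2)
    (p : Fin (k + 1)) :
    face p.succ (jointSimplex hM D l ε (shift α (flip p a)))
      = face p.succ (jointSimplex hM D l ε (shift α a)) := by
  ext u
  refine Subtype.ext ?_
  change jointPoint D l ε _ (stdSimplex.map p.succ.succAbove u)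
    = jointPoint D l ε _ (stdSimplex.map p.succ.succAbove u)
  simp only [jointPoint]
  congr 1
  funext i
  by_cases hi : i = p
  · subst hi
    have h0 : (1 / (M i : ℝ)) ≠ 0 := by
      have : (M i : ℝ) ≠ 0 := by exact_mod_cast (by have := hM i; omega : M i ≠ 0)
      positivity
    rw [map_succAbove_self, zero_div, Real.zero_rpow h0]
    simp
  · simp [shift, flip, Function.update_of_ne hi]

lemma jointChain_d (hM : ∀ i, 2 ≤ M i) (D : JointSystem M P) (l : Fin (P.natDegree - 1))
    (α : IndexJ M) :
    jointChain hM D l α ≫ (singularChains (hypersurface (affinePoly M P))).d (k + 1) k = 0 := by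
  simp only [jointChain, Preadditive.sum_comp, Preadditive.zsmul_comp, Preadditive.sub_comp,
    simplexInclusion_d, ← Finset.sum_sub_distrib, ← smul_sub]
  simp only [Finset.smul_sum]
  rw [Finset.sum_comm]
  refine Finset.sum_eq_zero fun i _ => ?_
  refine Fin.cases ?_ (fun p => ?_) i
  · refine Finset.sum_eq_zero fun a _ => ?_
    rw [face_zero_jointSimplex, sub_self, smul_zero, smul_zero]
  · refine Finset.sum_involution (fun a _ => flip p a) (fun a _ => ?_) (fun a _ _ => flip_ne p a)
      (fun _ _ => Finset.mem_univ _) (fun a _ => flip_flip p a)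
    rw [cornerSign_flip, face_succ_jointSimplex, face_succ_jointSimplex, neg_smul,
      add_neg_cancel]

/-- The joint cycle `δ_l * δ_α`, as a class in `H_n(U, ℚ)`. -/
def jointCycle (hM : ∀ i, 2 ≤ M i) (D : JointSystem M P) (l : Fin (P.natDegree - 1))
    (α : IndexJ M) : affineHomology M P :=
  ((singularChains (hypersurface (affinePoly M P))).liftCycles (jointChain hM D l α) k
      (ChainComplex.next_nat_succ k) (jointChain_d hM D l α)
    ≫ (singularChains (hypersurface (affinePoly M P))).homologyπ (k + 1)).hom (1 : ℚ)

/-- The map `(n_{α,l}) ↦ ∑_{l,α} n_{α,l} δ_l * δ_α`. -/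
def jointMap (hM : ∀ i, 2 ≤ M i) (D : JointSystem M P) :
    (IndexJ M × Fin (P.natDegree - 1) → ℚ) →ₗ[ℚ] affineHomology M P :=
  Fintype.linearCombination ℚ fun x => jointCycle hM D x.2 x.1

/-- The strong generic Hodge cycles `SHod_n(X, ℚ)_0`: the image of `𝒜` under the natural map
`(n_{α,l}) ↦ [∑_{l,α} n_{α,l} δ_l * δ_α]`. -/
def SHod (hM : ∀ i, 2 ≤ M i) (D : JointSystem M P) : Submodule ℚ (PrimitiveHomology M P) :=
  (spaceA M P.natDegree).map ((orthogonalClasses M P (k + 2)).mkQ ∘ₗ jointMap hM D)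

end Joint

end HodgeJoin

end

/-!
The space `SHod` is a linear image of `𝒜`, so it suffices to bound the dimension of `𝒜`.

By Euler's identity the vector field with components `-x^β x_j / m_j` represents the residue of
`x^β dx / (g + 1)` (`isResidue_eulerResidue`). On a Pham simplex, parametrized by barycentric
coordinates `u_j`, its integral is a phase times the Dirichlet integral of
`∏ u_j ^ ((β_j + 1) / m_j - 1)`, which converges and is positive (`integrableOn_dirichlet`,
`dirichlet_pos`). Hence the period over `δ_α` is a nonzero constant times
`∏ ζ_{m_i} ^ ((β_i + 1) α_i)` (`exists_fermatPeriod_eq`), and membership in `𝒜` says that certain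
character sums with rational coefficients vanish (`charSum_eq_zero_of_mem_spaceA`).

All character sums with exponents `1 ≤ b_i < m_i` together determine the coefficients
(`eq_zero_of_charSum_eq_zero`), and Galois conjugation multiplies the exponents by any number
prime to the `m_i` (`charSum_mul_eq_zero`). Under the hypotheses on the exponents every `b` is
conjugate to `(1, …, 1, q / d)` with `q = m_n`, for a divisor `d ≥ 2` of `q`. If `d` exceeds the
stated bound, the corresponding form has weight less than `n / 2`, and its character sum vanishes
on `𝒜`. For the other `d` the character sum takes values in `ℚ(ζ_d)`, respectively `ℚ(ζ_{pd})`,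
of dimension `φ(d)`, respectively `(p - 1) φ(d)`. Each of the `m - 1` slices of `𝒜` therefore
embeds into the sum of these fields over `d` up to the bound.
-/

namespace HodgeJoin

open MeasureTheory

/-! ### The Dirichlet integral over the simplex -/

/-- The barycentric coordinates `(1 - ∑ t_i, t_1, …, t_k)` of a point of the simplex. -/
def barycentric {k : ℕ} (t : Fin k → ℝ) : Fin (k + 1) → ℝ := Fin.cons (1 - ∑ i, t i) t

/-- The open simplex, in the coordinates `(t_1, …, t_k)`. -/
def openSimplex (k : ℕ) : Set (Fin k → ℝ) := {t | ∀ j, 0 < barycentric t j}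

@[simp] lemma barycentric_zero {k : ℕ} (t : Fin k → ℝ) : barycentric t 0 = 1 - ∑ i, t i := rfl

@[simp] lemma barycentric_succ {k : ℕ} (t : Fin k → ℝ) (i : Fin k) :
    barycentric t i.succ = t i := rfl

lemma sum_barycentric {k : ℕ} (t : Fin k → ℝ) : ∑ j, barycentric t j = 1 := by
  simp [Fin.sum_univ_succ]

lemma continuous_barycentric {k : ℕ} (j : Fin (k + 1)) :
    Continuous fun t : Fin k → ℝ => barycentric t j := by
  refine Fin.cases ?_ (fun i => ?_) j
  · simp only [barycentric_zero]; fun_prop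
  · simp only [barycentric_succ]; fun_prop

lemma isOpen_openSimplex (k : ℕ) : IsOpen (openSimplex k) := by
  simp only [openSimplex, Set.ofPred_forall]
  exact isOpen_iInter_of_finite fun j => isOpen_lt continuous_const (continuous_barycentric j)

lemma mem_simplexDomain_iff {k : ℕ} (t : Fin k → ℝ) :
    t ∈ simplexDomain k ↔ ∀ j, 0 ≤ barycentric t j := by
  simp [simplexDomain, Fin.forall_fin_succ, and_comm]

lemma openSimplex_subset (k : ℕ) : openSimplex k ⊆ simplexDomain k := fun t ht =>
  (mem_simplexDomain_iff t).2 fun j => (ht j).le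

lemma openSimplex_nonempty (k : ℕ) : (openSimplex k).Nonempty := by
  refine ⟨fun _ => 1 / (k + 1), fun j => ?_⟩
  refine Fin.cases ?_ (fun i => ?_) j
  · have : (0 : ℝ) < k + 1 := by positivity
    simp only [barycentric_zero, Finset.sum_const, Finset.card_univ, Fintype.card_fin,
      nsmul_eq_mul]
    rw [mul_one_div, sub_pos, div_lt_one this]
    linarith
  · simp only [barycentric_succ]; positivity

lemma barycentric_le_one {k : ℕ} {t : Fin k → ℝ} (ht : t ∈ openSimplex k) (j : Fin (k + 1)) :
    barycentric t j ≤ 1 := by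
  rw [← sum_barycentric t]
  exact Finset.single_le_sum (fun i _ => (ht i).le) (Finset.mem_univ j)

/-- Exchanging the barycentric coordinates `0` and `i` preserves the volume: the linear part
of this affine map is an involution, so it has determinant `±1`. -/
lemma measurePreserving_exchange {k : ℕ} (i : Fin k) :
    MeasurePreserving (fun t : Fin k → ℝ => Function.update t i (1 - ∑ j, t j)) := by
  let L : (Fin k → ℝ) →ₗ[ℝ] (Fin k → ℝ) :=
    { toFun := fun t => Function.update t i (-∑ j, t j)
      map_add' := fun s t => by
        ext j
        by_cases h : j = i
        · subst h; simp [Finset.sum_add_distrib, add_comm]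
        · simp [h]
      map_smul' := fun c t => by
        ext j
        by_cases h : j = i
        · subst h; simp [Finset.mul_sum]
        · simp [h] }
  have hL : ∀ t, L t = Function.update t i (-∑ j, t j) := fun _ => rfl
  have hLL : L ∘ₗ L = LinearMap.id := by
    refine LinearMap.ext fun t => ?_
    rw [LinearMap.comp_apply, hL, hL t, Function.update_idem]
    simp only [LinearMap.id_apply]
    rw [Function.update_eq_iff]
    refine ⟨?_, fun _ _ => rfl⟩
    rw [Finset.sum_update_of_mem (Finset.mem_univ i),
      Finset.sum_eq_add_sum_sdiff_singleton_of_mem (Finset.mem_univ i) t]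
    ring
  have hdet : LinearMap.det L * LinearMap.det L = 1 := by
    rw [← LinearMap.det_comp, hLL, LinearMap.det_id]
  have habs : |LinearMap.det L| = 1 := by
    have : |LinearMap.det L| * |LinearMap.det L| = 1 := by rw [← abs_mul, hdet, abs_one]
    nlinarith [abs_nonneg (LinearMap.det L)]
  have hLmp : MeasurePreserving L := by
    refine ⟨L.continuous_of_finiteDimensional.measurable, ?_⟩
    rw [Real.map_linearMap_volume_pi_eq_smul_volume_pi (left_ne_zero_of_mul_eq_one hdet),
      abs_inv, habs]
    simp
  have := (measurePreserving_add_right volume (Pi.single i (1 : ℝ))).comp hLmp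
  refine (congrArg (fun φ : (Fin k → ℝ) → (Fin k → ℝ) => MeasurePreserving φ) ?_).mp this
  funext t j
  by_cases h : j = i
  · subst h
    simp [hL]
    ring
  · simp [hL, h]

lemma ae_barycentric_ne_zero {k : ℕ} (j : Fin (k + 1)) :
    ∀ᵐ t : Fin k → ℝ, barycentric t j ≠ 0 := by
  have hcoord : ∀ i : Fin k, volume {t : Fin k → ℝ | t i = 0} = 0 := fun i =>
    Measure.pi_hyperplane _ i 0
  refine Fin.cases ?_ (fun i => ?_) j
  · rcases k with _ | k
    · exact Filter.Eventually.of_forall fun t => by simp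
    · have h := (measurePreserving_exchange (0 : Fin (k + 1))).measure_preimage
        (measurableSet_eq_fun (measurable_pi_apply 0)
          (measurable_const (a := (0 : ℝ)))).nullMeasurableSet
      rw [hcoord 0] at h
      rw [ae_iff]
      refine measure_mono_null (fun t ht => ?_) h
      simpa using ht
  · rw [ae_iff]
    simpa using hcoord i

lemma openSimplex_ae_eq (k : ℕ) : openSimplex k =ᵐ[volume] simplexDomain k := by
  filter_upwards [ae_all_iff.2 fun j => ae_barycentric_ne_zero (k := k) j] with t ht
  refine propext ⟨fun h => openSimplex_subset k h, fun h => ?_⟩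
  exact fun j => lt_of_le_of_ne ((mem_simplexDomain_iff t).1 h j) (ht j).symm

/-- A product of integrable functions of all but one of the barycentric coordinates is
integrable. -/
lemma integrable_prod_barycentric {k : ℕ} (h : Fin (k + 1) → ℝ → ℝ)
    (hh : ∀ j, Integrable (h j)) (j₀ : Fin (k + 1)) :
    Integrable fun t : Fin k → ℝ => ∏ j, if j = j₀ then 1 else h j (barycentric t j) := by
  refine Fin.cases ?_ (fun i => ?_) j₀
  · simp only [Fin.prod_univ_succ, if_true, one_mul, barycentric_succ, Fin.succ_ne_zero, if_false]
    exact Integrable.fintype_prod fun i => hh i.succ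
  · have h1 : Integrable fun t : Fin k → ℝ => ∏ l, (if l = i then h 0 else h l.succ) (t l) :=
      Integrable.fintype_prod (f := fun l => if l = i then h 0 else h l.succ) fun l => by
        split_ifs
        exacts [hh 0, hh l.succ]
    have h2 := (measurePreserving_exchange i).integrable_comp_of_integrable h1
    refine h2.congr (Filter.Eventually.of_forall fun t => ?_)
    simp only [Function.comp_apply, Fin.prod_univ_succ, barycentric_zero, barycentric_succ,
      Fin.succ_inj, (Fin.succ_ne_zero i).symm, if_false]
    rw [← Finset.mul_prod_erase _ _ (Finset.mem_univ i),
      ← Finset.mul_prod_erase Finset.univ (fun l => if l = i then 1 else h l.succ (t l))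
        (Finset.mem_univ i)]
    simp only [if_true, Function.update_self, one_mul]
    congr 1
    refine Finset.prod_congr rfl fun l hl => ?_
    have hl' := Finset.ne_of_mem_erase hl
    simp [hl']

/-- The Dirichlet density is integrable. At each point of the simplex some barycentric
coordinate is at least `1 / (k + 1)`; the factor of that coordinate is bounded, and the
other coordinates can be taken as independent variables. -/
lemma integrableOn_dirichlet {k : ℕ} (a : Fin (k + 1) → ℝ) (h0 : ∀ j, 0 < a j)
    (h1 : ∀ j, a j ≤ 1) :
    IntegrableOn (fun t : Fin k → ℝ => ∏ j, barycentric t j ^ (a j - 1)) (openSimplex k) := by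
  -- Any cutoff beyond `1` serves: a barycentric coordinate may equal `1` only when `k = 0`.
  let h : Fin (k + 1) → ℝ → ℝ := fun j => (Set.Ioo (0 : ℝ) 2).indicator fun x => x ^ (a j - 1)
  have hh : ∀ j, Integrable (h j) := fun j =>
    ((intervalIntegral.integrableOn_Ioo_rpow_iff two_pos).2 (by linarith [h0 j])).integrable_indicator
        measurableSet_Ioo
  have hdom : Integrable fun t : Fin k → ℝ =>
      ∑ j₀, ((k : ℝ) + 1) * ∏ j, if j = j₀ then 1 else h j (barycentric t j) :=
    integrable_finsetSum _ fun j₀ _ => (integrable_prod_barycentric h hh j₀).const_mul _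
  refine Integrable.mono' hdom.integrableOn ?_ ?_
  · refine ContinuousOn.aestronglyMeasurable ?_ (isOpen_openSimplex k).measurableSet
    refine continuousOn_finsetProd _ fun j _ => ?_
    exact (continuous_barycentric j).continuousOn.rpow_const fun t ht => Or.inl (ht j).ne'
  · refine (ae_restrict_iff' (isOpen_openSimplex k).measurableSet).2
      (Filter.Eventually.of_forall fun t ht => ?_)
    have hval : ∀ j, h j (barycentric t j) = barycentric t j ^ (a j - 1) := fun j =>
      Set.indicator_of_mem (s := Set.Ioo (0 : ℝ) 2)
        ⟨ht j, (barycentric_le_one ht j).trans_lt one_lt_two⟩ _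
    simp only [hval]
    have hpos : ∀ j, 0 < barycentric t j ^ (a j - 1) := fun j => Real.rpow_pos_of_pos (ht j) _
    have hk : (0 : ℝ) < k + 1 := by positivity
    obtain ⟨j₀, hj₀⟩ : ∃ j₀, 1 / ((k : ℝ) + 1) ≤ barycentric t j₀ := by
      by_contra! hlt
      have := Finset.sum_lt_sum_of_nonempty (Finset.univ_nonempty (α := Fin (k + 1)))
        fun j _ => hlt j
      rw [sum_barycentric] at this
      simp only [Finset.sum_const, Finset.card_univ, Fintype.card_fin, nsmul_eq_mul] at this
      push_cast at this
      rw [mul_one_div_cancel hk.ne'] at this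
      exact lt_irrefl _ this
    rw [Real.norm_of_nonneg (Finset.prod_nonneg fun j _ => (hpos j).le)]
    have hnn : ∀ j₁, 0 ≤ ((k : ℝ) + 1) *
        ∏ j, if j = j₁ then 1 else barycentric t j ^ (a j - 1) := fun j₁ =>
      mul_nonneg hk.le (Finset.prod_nonneg fun j _ => by
        split_ifs
        exacts [zero_le_one, (hpos j).le])
    refine le_trans ?_ (Finset.single_le_sum (fun j₁ _ => hnn j₁) (Finset.mem_univ j₀))
    rw [← Finset.mul_prod_erase _ _ (Finset.mem_univ j₀),
      ← Finset.mul_prod_erase Finset.univ (fun j => if j = j₀ then 1 else barycentric t j ^ (a j - 1))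
        (Finset.mem_univ j₀)]
    rw [if_pos rfl, one_mul, Finset.prod_congr rfl fun j hj => if_neg (Finset.ne_of_mem_erase hj)]
    refine mul_le_mul_of_nonneg_right ?_ (Finset.prod_nonneg fun j _ => (hpos j).le)
    calc barycentric t j₀ ^ (a j₀ - 1) ≤ (1 / ((k : ℝ) + 1)) ^ (a j₀ - 1) :=
          Real.rpow_le_rpow_of_nonpos (by positivity) hj₀ (by linarith [h1 j₀])
      _ = ((k : ℝ) + 1) ^ (1 - a j₀) := by
          rw [one_div, Real.inv_rpow hk.le, ← Real.rpow_neg hk.le, neg_sub]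
      _ ≤ ((k : ℝ) + 1) ^ (1 : ℝ) :=
          Real.rpow_le_rpow_of_exponent_le (by linarith [(Nat.cast_nonneg k : (0 : ℝ) ≤ k)])
            (by linarith [h0 j₀])
      _ = (k : ℝ) + 1 := Real.rpow_one _

lemma dirichlet_pos {k : ℕ} (a : Fin (k + 1) → ℝ) (h0 : ∀ j, 0 < a j) (h1 : ∀ j, a j ≤ 1) :
    0 < ∫ t in openSimplex k, ∏ j, barycentric t j ^ (a j - 1) := by
  have hpos : ∀ t ∈ openSimplex k, 0 < ∏ j, barycentric t j ^ (a j - 1) := fun t ht =>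
    Finset.prod_pos fun j _ => Real.rpow_pos_of_pos (ht j) _
  rw [setIntegral_pos_iff_support_of_nonneg_ae
    ((ae_restrict_iff' (isOpen_openSimplex k).measurableSet).2
      (Filter.Eventually.of_forall fun t ht => (hpos t ht).le))
    (integrableOn_dirichlet a h0 h1)]
  rw [Set.inter_eq_right.2 (show openSimplex k ⊆ Function.support _ from
    fun t ht => (hpos t ht).ne')]
  exact (isOpen_openSimplex k).measure_pos _ (openSimplex_nonempty k)

/-! ### Character sums on the index set `J` -/

lemma zetaRoot_isPrimitiveRoot {m : ℕ} (hm : m ≠ 0) : IsPrimitiveRoot (zetaRoot m) m :=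
  Complex.isPrimitiveRoot_exp m hm

lemma zetaRoot_pow_div {d m : ℕ} (hm : m ≠ 0) (h : d ∣ m) :
    zetaRoot m ^ (m / d) = zetaRoot d := by
  have hm' : (m : ℂ) ≠ 0 := by exact_mod_cast hm
  have hd' : (d : ℂ) ≠ 0 := by exact_mod_cast ne_zero_of_dvd_ne_zero hm h
  rw [zetaRoot, zetaRoot, ← Complex.exp_nat_mul, Nat.cast_div h hd']
  congr 1
  field_simp

/-- The character sum `∑_α ν_α ∏_i ζ_{m_i} ^ (b_i α_i)`. -/
noncomputable def charSum {k : ℕ} (M : Fin (k + 1) → ℕ) (b : Fin (k + 1) → ℕ) :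
    (IndexJ M → ℚ) →ₗ[ℚ] ℂ :=
  Fintype.linearCombination ℚ fun α => ∏ i, zetaRoot (M i) ^ (b i * (α i : ℕ))

lemma charSum_apply {k : ℕ} (M : Fin (k + 1) → ℕ) (b : Fin (k + 1) → ℕ) (ν : IndexJ M → ℚ) :
    charSum M b ν = ∑ α, (ν α : ℂ) * ∏ i, zetaRoot (M i) ^ (b i * (α i : ℕ)) := by
  simp [charSum, Fintype.linearCombination_apply, Rat.smul_def]

/-- The characters with exponents `1 ≤ b_i < m_i` separate the functions on `J`: a polynomial
of degree at most `m_i - 2` in the `i`-th variable that vanishes on a product of sets of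
`m_i - 1` points is zero. -/
lemma eq_zero_of_charSum_eq_zero {k : ℕ} {M : Fin (k + 1) → ℕ} (hM : ∀ i, 2 ≤ M i)
    (ν : IndexJ M → ℚ)
    (h : ∀ b : Fin (k + 1) → ℕ, (∀ i, 1 ≤ b i ∧ b i < M i) → charSum M b ν = 0) : ν = 0 := by
  classical
  let e : IndexJ M → (Fin (k + 1) →₀ ℕ) := fun α => Finsupp.equivFunOnFinite.symm fun i => (α i : ℕ)
  have he : Function.Injective e := fun α α' hα => by
    funext i
    exact Fin.ext (DFunLike.congr_fun hα i)
  let F : MvPolynomial (Fin (k + 1)) ℂ := ∑ α, MvPolynomial.monomial (e α) (ν α : ℂ)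
  let S : Fin (k + 1) → Finset ℂ := fun i =>
    (Finset.Ico 1 (M i)).image fun b => zetaRoot (M i) ^ b
  have hS : ∀ i, (S i).card = M i - 1 := fun i => by
    rw [Finset.card_image_of_injOn, Nat.card_Ico]
    intro b hb b' hb' hbb
    simp only [Finset.coe_Ico, Set.mem_Ico] at hb hb'
    exact (zetaRoot_isPrimitiveRoot (by have := hM i; omega)).pow_inj hb.2 hb'.2 hbb
  have hF : F = 0 := by
    refine MvPolynomial.eq_zero_of_eval_zero_at_prod_finset F S (fun i => ?_) fun x hx => ?_
    · rw [hS]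
      have h2 := hM i
      refine lt_of_le_of_lt (MvPolynomial.degreeOf_sum_le i _ _) ?_
      rw [Finset.sup_lt_iff (by show 0 < M i - 1; omega)]
      intro α _
      by_cases h0 : (ν α : ℂ) = 0
      · rw [h0, map_zero, MvPolynomial.degreeOf_zero]
        show 0 < M i - 1
        omega
      · rw [MvPolynomial.degreeOf_monomial_eq _ _ h0]
        exact (α i).2
    · have : ∀ i, ∃ b, (1 ≤ b ∧ b < M i) ∧ zetaRoot (M i) ^ b = x i := fun i => by
        simpa [S] using hx i
      choose b hb hbx using this
      rw [← h b hb, charSum_apply]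
      simp only [F, map_sum, MvPolynomial.eval_monomial]
      refine Finset.sum_congr rfl fun α _ => ?_
      rw [Finsupp.prod_fintype _ _ fun i => pow_zero _]
      congr 1
      refine Finset.prod_congr rfl fun i _ => ?_
      rw [← hbx, pow_mul]
      rfl
  funext α
  have hc := congrArg (MvPolynomial.coeff (e α)) hF
  simp only [F, MvPolynomial.coeff_sum, MvPolynomial.coeff_monomial, he.eq_iff,
    Finset.sum_ite_eq', Finset.mem_univ, if_true, MvPolynomial.coeff_zero] at hc
  exact_mod_cast hc

/-- Galois conjugation: the vanishing of a character sum with rational coefficients is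
preserved when the exponents are multiplied by a number prime to all `m_i`. -/
lemma charSum_mul_eq_zero {k : ℕ} {M : Fin (k + 1) → ℕ} (hM : ∀ i, 2 ≤ M i)
    {ν : IndexJ M → ℚ} {b : Fin (k + 1) → ℕ} (h : charSum M b ν = 0) {c : ℕ}
    (hc : c.Coprime (∏ i, M i)) : charSum M (fun i => c * b i) ν = 0 := by
  set L := ∏ i, M i with hLdef
  have hL : L ≠ 0 := Finset.prod_ne_zero_iff.2 fun i _ => by have := hM i; omega
  have hζ := zetaRoot_isPrimitiveRoot hL
  have hroot : ∀ i, zetaRoot (M i) = zetaRoot L ^ (L / M i) := fun i =>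
    (zetaRoot_pow_div hL (Finset.dvd_prod_of_mem M (Finset.mem_univ i))).symm
  let G : Polynomial ℚ := ∑ α : IndexJ M,
    Polynomial.C (ν α) * Polynomial.X ^ (∑ i, L / M i * (b i * (α i : ℕ)))
  have hG : ∀ c : ℕ, Polynomial.aeval (zetaRoot L ^ c) G = charSum M (fun i => c * b i) ν := by
    intro c
    rw [charSum_apply]
    simp only [G, map_sum, map_mul, Polynomial.aeval_C, map_pow, Polynomial.aeval_X]
    refine Finset.sum_congr rfl fun α _ => ?_
    congr 1
    rw [← Finset.prod_pow_eq_pow_sum]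
    refine Finset.prod_congr rfl fun i _ => ?_
    rw [hroot, ← pow_mul, ← pow_mul]
    congr 1
    ring
  have h1 : Polynomial.aeval (zetaRoot L) G = 0 := by
    have := hG 1
    simp only [pow_one, one_mul] at this
    rw [this, h]
  have hdvd := minpoly.dvd ℚ (zetaRoot L) h1
  rw [← Polynomial.cyclotomic_eq_minpoly_rat hζ (Nat.pos_of_ne_zero hL),
    Polynomial.cyclotomic_eq_minpoly_rat (hζ.pow_of_coprime c hc) (Nat.pos_of_ne_zero hL)] at hdvd
  rw [← hG c]
  obtain ⟨Q, hQ⟩ := hdvd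
  rw [hQ, map_mul, minpoly.aeval, zero_mul]

lemma charSum_congr {k : ℕ} {M : Fin (k + 1) → ℕ} (hM : ∀ i, 2 ≤ M i)
    {b b' : Fin (k + 1) → ℕ} (h : ∀ i, b i ≡ b' i [MOD M i]) (ν : IndexJ M → ℚ) :
    charSum M b ν = charSum M b' ν := by
  rw [charSum_apply, charSum_apply]
  refine Finset.sum_congr rfl fun α _ => ?_
  congr 1
  refine Finset.prod_congr rfl fun i _ => ?_
  rw [pow_mul, pow_mul]
  congr 1
  have hp := zetaRoot_isPrimitiveRoot (m := M i) (by have := hM i; omega)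
  rw [← pow_mod_orderOf, ← hp.eq_orderOf, h i]
  conv_rhs => rw [← pow_mod_orderOf, ← hp.eq_orderOf]

/-- Units modulo a divisor lift to units. -/
lemma exists_modEq_coprime {a d L : ℕ} (hL : L ≠ 0) (hd : d ∣ L) (ha : a.Coprime d) :
    ∃ c, c ≡ a [MOD d] ∧ c.Coprime L := by
  have : NeZero L := ⟨hL⟩
  obtain ⟨u, hu⟩ := ZMod.unitsMap_surjective hd (ZMod.unitOfCoprime a ha)
  refine ⟨(u : ZMod L).val, ?_, ZMod.val_coe_unit_coprime u⟩
  rw [← ZMod.natCast_eq_natCast_iff]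
  have := congrArg Units.val hu
  rw [ZMod.unitsMap_val, ZMod.coe_unitOfCoprime] at this
  rw [← this, ZMod.natCast_val]

/-! ### Periods of the Pham cycles -/

/-- The vector field `R` with `R_j = -x^β x_j / m_j`. By Euler's identity, `ι_R dx` is the
residue of `x^β dx / (g + 1)`. -/
noncomputable def eulerResidue {k : ℕ} (M : Fin (k + 1) → ℕ) (β : Fin (k + 1) → ℕ)
    (j : Fin (k + 1)) : MvPolynomial (Fin (k + 1)) ℂ :=
  -(MvPolynomial.C (1 / (M j : ℂ)) * mono β * MvPolynomial.X j)

lemma mono_eq_monomial {N : ℕ} (β : Fin N → ℕ) :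
    mono β = MvPolynomial.monomial (Finsupp.equivFunOnFinite.symm β) 1 := by
  rw [MvPolynomial.monomial_eq, map_one, one_mul, Finsupp.prod_fintype _ _ fun i => pow_zero _]
  rfl

lemma pderiv_fermat {k : ℕ} (M : Fin (k + 1) → ℕ) (i : Fin (k + 1)) :
    MvPolynomial.pderiv i (fermat M + 1)
      = (M i : MvPolynomial (Fin (k + 1)) ℂ) * MvPolynomial.X i ^ (M i - 1) := by
  rw [fermat, map_add, map_sum, Finset.sum_eq_single i]
  · simp
  · intro j _ hj
    rw [MvPolynomial.pderiv_pow, MvPolynomial.pderiv_X_of_ne hj, mul_zero]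
  · simp

lemma isResidue_eulerResidue {k : ℕ} {M : Fin (k + 1) → ℕ} (hM : ∀ i, 2 ≤ M i)
    (β : Fin (k + 1) → ℕ) : IsResidue (fermat M + 1) (mono β) 1 (eulerResidue M β) := by
  -- Euler's identity gives `x^β = ∑ R_j ∂_j h + h x^β`, so `Ξ` only has to have divergence `x^β`.
  refine ⟨Pi.single 0 (MvPolynomial.C (1 / ((β 0 : ℂ) + 1)) * (mono β * MvPolynomial.X 0)), ?_⟩
  have hdiv : ∑ i, MvPolynomial.pderiv i ((Pi.single 0 (MvPolynomial.C (1 / ((β 0 : ℂ) + 1)) *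
      (mono β * MvPolynomial.X 0)) : Fin (k + 1) → MvPolynomial (Fin (k + 1)) ℂ) i)
        = mono β := by
    rw [Finset.sum_eq_single 0 (fun j _ hj => by rw [Pi.single_eq_of_ne hj, map_zero])
      (by simp), Pi.single_eq_same, MvPolynomial.pderiv_C_mul, mono_eq_monomial, MvPolynomial.X,
      MvPolynomial.monomial_mul, MvPolynomial.pderiv_monomial, add_tsub_cancel_right,
      MvPolynomial.C_mul_monomial]
    congr 1
    have : (β 0 : ℂ) + 1 ≠ 0 := by exact_mod_cast Nat.succ_ne_zero (β 0)
    simp [this]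
  have heuler : ∑ i, eulerResidue M β i * MvPolynomial.pderiv i (fermat M + 1)
      = -(mono β * fermat M) := by
    rw [fermat, Finset.mul_sum, ← Finset.sum_neg_distrib]
    refine Finset.sum_congr rfl fun i _ => ?_
    rw [← fermat, pderiv_fermat, eulerResidue]
    have h1 : MvPolynomial.C (1 / (M i : ℂ)) * (M i : MvPolynomial (Fin (k + 1)) ℂ) = 1 := by
      have hMi : (M i : ℂ) ≠ 0 := by exact_mod_cast (by have := hM i; omega : M i ≠ 0)
      rw [← map_natCast (MvPolynomial.C (σ := Fin (k + 1)) (R := ℂ)), ← map_mul,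
        one_div_mul_cancel hMi, map_one]
    have h2 : (MvPolynomial.X i : MvPolynomial (Fin (k + 1)) ℂ) ^ M i
        = MvPolynomial.X i * MvPolynomial.X i ^ (M i - 1) := by
      rw [← pow_succ']
      congr 1
      have := hM i
      omega
    rw [h2]
    linear_combination (-(mono β * MvPolynomial.X i * MvPolynomial.X i ^ (M i - 1))) * h1
  rw [hdiv, heuler]
  simp only [Nat.sub_self, pow_zero, Nat.cast_zero, zero_mul, sub_zero]
  ring

/-- The determinant with first row `u`, `∑ u_j = 1`, and with the partial derivatives of the
barycentric coordinates as its other rows. -/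
lemma det_barycentric {k : ℕ} (u : Fin (k + 1) → ℂ) (hu : ∑ j, u j = 1) :
    Matrix.det (Matrix.of (Fin.cons u fun i : Fin k =>
      (Fin.cons (-1) (Pi.single i 1) : Fin (k + 1) → ℂ))) = 1 := by
  set B : Matrix (Fin (k + 1)) (Fin (k + 1)) ℂ := Matrix.of (Fin.cons u fun i : Fin k =>
      (Fin.cons (-1) (Pi.single i 1) : Fin (k + 1) → ℂ)) with hB
  have h := Matrix.det_updateCol_sum B 0 (fun _ => 1)
  simp only [one_smul] at h
  have hrow : (fun l => ∑ i, B l i) = Pi.single 0 1 := by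
    funext l
    refine Fin.cases ?_ (fun l => ?_) l
    · simpa [hB] using hu
    · simp [hB, Fin.sum_univ_succ]
  rw [← h, hrow, Matrix.det_succ_column_zero, Finset.sum_eq_single 0]
  · simp only [Fin.val_zero, pow_zero, Matrix.updateCol_self, Pi.single_eq_same, one_mul]
    convert Matrix.det_one (R := ℂ) (n := Fin k)
    ext i j
    rw [Matrix.submatrix_apply, Matrix.updateCol_ne (by simp [Fin.succ_ne_zero])]
    simp [hB, Matrix.one_apply, Pi.single_apply, eq_comm]
  · intro l _ hl
    rw [Matrix.updateCol_self, Pi.single_eq_of_ne hl]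
    ring
  · simp

/-- The derivative of the `j`-th barycentric coordinate. -/
noncomputable def barycentricDeriv {k : ℕ} (j : Fin (k + 1)) : (Fin k → ℝ) →L[ℝ] ℝ :=
  Fin.cases (-∑ i, ContinuousLinearMap.proj i) (fun i => ContinuousLinearMap.proj i) j

lemma hasFDerivAt_barycentric {k : ℕ} (j : Fin (k + 1)) (t : Fin k → ℝ) :
    HasFDerivAt (fun t : Fin k → ℝ => barycentric t j) (barycentricDeriv j) t := by
  refine Fin.cases ?_ (fun i => ?_) j
  · simp only [barycentric_zero, barycentricDeriv, Fin.cases_zero]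
    exact (HasFDerivAt.fun_sum fun i _ => hasFDerivAt_apply i t).const_sub 1
  · simpa only [barycentric_succ, barycentricDeriv, Fin.cases_succ] using hasFDerivAt_apply i t

lemma barycentricDeriv_single {k : ℕ} (j : Fin (k + 1)) (i : Fin k) :
    barycentricDeriv j (Pi.single i 1) = (Fin.cons (-1) (Pi.single i 1) : Fin (k + 1) → ℝ) j := by
  refine Fin.cases ?_ (fun l => ?_) j
  · simp [barycentricDeriv, Finset.sum_pi_single']
  · simp [barycentricDeriv]

lemma inCoordinates_phamSimplex {k : ℕ} (M : Fin (k + 1) → ℕ) (ρ : Fin (k + 1) → ℂ)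
    (e : Fin (k + 1) → ℕ) {t : Fin k → ℝ} (ht : t ∈ simplexDomain k) :
    inCoordinates (phamSimplex M ρ e) t = fun j =>
      ((barycentric t j ^ (1 / (M j : ℝ)) : ℝ) : ℂ) * (zetaRoot (M j) ^ e j * ρ j) := by
  funext j
  rw [inCoordinates, dif_pos ht, phamSimplex, mul_assoc]
  rfl

lemma fderivWithin_phamSimplex {k : ℕ} (M : Fin (k + 1) → ℕ) (ρ : Fin (k + 1) → ℂ)
    (e : Fin (k + 1) → ℕ) {t : Fin k → ℝ} (ht : t ∈ openSimplex k) (i : Fin k) (j : Fin (k + 1)) :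
    fderivWithin ℝ (inCoordinates (phamSimplex M ρ e)) (simplexDomain k) t (Pi.single i 1) j
      = ((1 / (M j : ℝ) * barycentric t j ^ (1 / (M j : ℝ) - 1) : ℝ) : ℂ)
        * (zetaRoot (M j) ^ e j * ρ j) * (Fin.cons (-1) (Pi.single i 1) : Fin (k + 1) → ℂ) j := by
  have hnhds : simplexDomain k ∈ nhds t :=
    Filter.mem_of_superset ((isOpen_openSimplex k).mem_nhds ht) (openSimplex_subset k)
  have hder : ∀ j, HasFDerivAt (fun t : Fin k → ℝ =>
      ((barycentric t j ^ (1 / (M j : ℝ)) : ℝ) : ℂ) * (zetaRoot (M j) ^ e j * ρ j))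
      ((zetaRoot (M j) ^ e j * ρ j) • (Complex.ofRealCLM.comp
        ((1 / (M j : ℝ) * barycentric t j ^ (1 / (M j : ℝ) - 1)) • barycentricDeriv j))) t :=
    fun j => (Complex.ofRealCLM.hasFDerivAt.comp t
      ((hasFDerivAt_barycentric j t).rpow_const (Or.inl (ht j).ne'))).mul_const _
  have heq : inCoordinates (phamSimplex M ρ e) =ᶠ[nhds t] fun t j =>
      ((barycentric t j ^ (1 / (M j : ℝ)) : ℝ) : ℂ) * (zetaRoot (M j) ^ e j * ρ j) := by
    filter_upwards [hnhds] with s hs using inCoordinates_phamSimplex M ρ e hs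
  rw [fderivWithin_of_mem_nhds hnhds, heq.fderiv_eq, (hasFDerivAt_pi.2 hder).fderiv]
  simp only [ContinuousLinearMap.coe_pi', smul_apply,
    ContinuousLinearMap.comp_apply, smul_eq_mul, Complex.ofRealCLM_apply, Complex.ofReal_mul,
    barycentricDeriv_single]
  have : (((Fin.cons (-1) (Pi.single i 1) : Fin (k + 1) → ℝ) j : ℝ) : ℂ)
      = (Fin.cons (-1) (Pi.single i 1) : Fin (k + 1) → ℂ) j := by
    refine Fin.cases ?_ (fun l => ?_) j
    · simp
    · simp only [Fin.cons_succ, Pi.single_apply]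
      split_ifs <;> simp
  rw [this]
  ring

lemma eval_eulerResidue {k : ℕ} (M : Fin (k + 1) → ℕ) (β : Fin (k + 1) → ℕ) (j : Fin (k + 1))
    (z : Fin (k + 1) → ℂ) :
    MvPolynomial.eval z (eulerResidue M β j) = -((∏ i, z i ^ β i) * (1 / (M j : ℂ) * z j)) := by
  simp only [eulerResidue, mono, map_neg, map_mul, MvPolynomial.eval_C, map_prod, map_pow,
    MvPolynomial.eval_X]
  ring

/-- The period of the residue of `x^β dx / (g + 1)` over a single Pham simplex is a phase
times a Dirichlet integral. -/
lemma simplexIntegral_phamSimplex {k : ℕ} (M : Fin (k + 1) → ℕ)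
    (ρ : Fin (k + 1) → ℂ) (e β : Fin (k + 1) → ℕ) :
    simplexIntegral (eulerResidue M β) (phamSimplex M ρ e)
      = -(∏ j, (zetaRoot (M j) ^ e j * ρ j) ^ (β j + 1) * (1 / (M j : ℂ)))
        * ((∫ t in openSimplex k,
            ∏ j, barycentric t j ^ (((β j : ℝ) + 1) / M j - 1) : ℝ) : ℂ) := by
  rw [simplexIntegral, ← setIntegral_congr_set (openSimplex_ae_eq k), ← integral_complex_ofReal,
    ← integral_const_mul]
  refine setIntegral_congr_fun (isOpen_openSimplex k).measurableSet fun t ht => ?_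
  set c : Fin (k + 1) → ℂ := fun j => zetaRoot (M j) ^ e j * ρ j with hc
  -- `v j` is the factor common to the `j`-th column: the coordinates of the simplex are
  -- `z j = c j * u_j ^ (1 / m_j)`, and both `∂_i z_j` and `z j / m_j` are multiples of `v j`.
  set v : Fin (k + 1) → ℂ := fun j =>
    ((1 / (M j : ℝ) * barycentric t j ^ (1 / (M j : ℝ) - 1) : ℝ) : ℂ) * c j with hv
  set z : Fin (k + 1) → ℂ := fun j => ((barycentric t j ^ (1 / (M j : ℝ)) : ℝ) : ℂ) * c j with hz
  have hzt : inCoordinates (phamSimplex M ρ e) t = z :=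
    inCoordinates_phamSimplex M ρ e (openSimplex_subset k ht)
  have hzv : ∀ j, 1 / (M j : ℂ) * z j = v j * (barycentric t j : ℂ) := fun j => by
    have : barycentric t j ^ (1 / (M j : ℝ))
        = barycentric t j ^ (1 / (M j : ℝ) - 1) * barycentric t j := by
      rw [← Real.rpow_add_one (ht j).ne', sub_add_cancel]
    simp only [hz, hv, this]
    push_cast
    ring
  have hmat : (Matrix.of (Fin.cons
      (fun j => MvPolynomial.eval (inCoordinates (phamSimplex M ρ e) t) (eulerResidue M β j))
      (fun i : Fin k => fderivWithin ℝ (inCoordinates (phamSimplex M ρ e)) (simplexDomain k) t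
        (Pi.single i 1)) : Fin (k + 1) → Fin (k + 1) → ℂ))
      = (Matrix.of fun i j => v j * (Matrix.updateRow (Matrix.of (Fin.cons
          (fun j => (barycentric t j : ℂ)) fun i : Fin k =>
            (Fin.cons (-1) (Pi.single i 1) : Fin (k + 1) → ℂ))) 0
          (-(∏ i, z i ^ β i) • fun j => (barycentric t j : ℂ))) i j) := by
    ext i j
    refine Fin.cases ?_ (fun i => ?_) i
    · simp only [Matrix.of_apply, Fin.cons_zero, Matrix.updateRow_self, Pi.smul_apply,
        smul_eq_mul]
      rw [hzt, eval_eulerResidue, hzv]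
      ring
    · simp only [Matrix.of_apply, Fin.cons_succ]
      rw [fderivWithin_phamSimplex M ρ e ht, Matrix.updateRow_ne (Fin.succ_ne_zero i)]
      simp only [Matrix.of_apply, Fin.cons_succ, hv, hc]
  have hdet := det_barycentric (fun j => (barycentric t j : ℂ))
    (by rw [← Complex.ofReal_sum, sum_barycentric, Complex.ofReal_one])
  rw [hmat, Matrix.det_mul_row, Matrix.det_updateRow_smul]
  have hself : Matrix.updateRow (Matrix.of (Fin.cons
          (fun j => (barycentric t j : ℂ)) fun i : Fin k =>
            (Fin.cons (-1) (Pi.single i 1) : Fin (k + 1) → ℂ))) 0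
          (fun j => (barycentric t j : ℂ)) = Matrix.of (Fin.cons
          (fun j => (barycentric t j : ℂ)) fun i : Fin k =>
            (Fin.cons (-1) (Pi.single i 1) : Fin (k + 1) → ℂ)) :=
    Matrix.updateRow_eq_self _ 0
  rw [hself, hdet, mul_one, mul_neg, neg_mul, ← Finset.prod_mul_distrib, Complex.ofReal_prod,
    ← Finset.prod_mul_distrib]
  congr 1
  refine Finset.prod_congr rfl fun j _ => ?_
  have hexp : barycentric t j ^ (((β j : ℝ) + 1) / M j - 1)
      = barycentric t j ^ (1 / (M j : ℝ) - 1) * (barycentric t j ^ (1 / (M j : ℝ))) ^ β j := by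
    rw [← Real.rpow_mul_natCast (ht j).le, ← Real.rpow_add (ht j)]
    congr 1
    ring
  rw [hexp]
  simp only [hv, hz]
  push_cast
  ring

/-- The periods of the residue of `x^β dx / (g + 1)` over the cycles `δ_α`, up to a constant
independent of `α`, are the values at `α` of the character with exponents `β_i + 1`. The
constant is nonzero when no `β_i + 1` is divisible by `m_i`. -/
lemma exists_fermatPeriod_eq {k : ℕ} {M : Fin (k + 1) → ℕ} (hM : ∀ i, 2 ≤ M i)
    {b : Fin (k + 1) → ℕ} (hb : ∀ i, 1 ≤ b i ∧ b i < M i) :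
    ∃ C : ℂ, C ≠ 0 ∧ ∀ α : IndexJ M, fermatPeriod M (eulerResidue M fun i => b i - 1) α
      = C * ∏ i, zetaRoot (M i) ^ (b i * (α i : ℕ)) := by
  set I : ℝ := ∫ t in openSimplex k,
    ∏ j, barycentric t j ^ (((((fun i => b i - 1) j : ℕ) : ℝ) + 1) / M j - 1) with hI
  have hMpos : ∀ j, (0 : ℝ) < M j := fun j => by exact_mod_cast (by have := hM j; omega : 0 < M j)
  have hbj : ∀ j, (((b j - 1 : ℕ) : ℝ) + 1) = b j := fun j => by
    exact_mod_cast Nat.sub_add_cancel (hb j).1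
  have hIpos : 0 < I := by
    refine dirichlet_pos _ (fun j => ?_) fun j => ?_
    · exact div_pos (by positivity) (hMpos j)
    · rw [div_le_one (hMpos j)]
      simp only [hbj]
      exact_mod_cast (hb j).2.le
  refine ⟨-(∏ j, ((zetaRoot (M j) ^ b j - 1) * (rootsNegOne M j ^ b j * (1 / (M j : ℂ))))) * I,
    ?_, fun α => ?_⟩
  · refine mul_ne_zero (neg_ne_zero.2 (Finset.prod_ne_zero_iff.2 fun j _ => mul_ne_zero ?_
      (mul_ne_zero (pow_ne_zero _ (Complex.exp_ne_zero _)) ?_))) (by exact_mod_cast hIpos.ne')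
    · have hp := zetaRoot_isPrimitiveRoot (m := M j) (by have := hM j; omega)
      exact sub_ne_zero.2 (hp.pow_ne_one_of_pos_of_lt (by have := (hb j).1; omega) (hb j).2)
    · exact one_div_ne_zero (by exact_mod_cast (hMpos j).ne')
  · simp only [fermatPeriod, simplexIntegral_phamSimplex]
    rw [← hI]
    have hterm : ∀ a : Fin (k + 1) → Fin 2, (cornerSign a : ℂ) *
        (-(∏ j, (zetaRoot (M j) ^ shift α a j * rootsNegOne M j) ^ (b j - 1 + 1)
          * (1 / (M j : ℂ))) * (I : ℂ))
        = -(∏ j, ((-1) ^ (1 - (a j : ℕ)) * (zetaRoot (M j) ^ ((α j : ℕ) + (a j : ℕ))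
          * rootsNegOne M j) ^ b j * (1 / (M j : ℂ)))) * I := fun a => by
      have hs : (cornerSign a : ℂ) = ∏ j, (-1 : ℂ) ^ (1 - (a j : ℕ)) := by
        rw [cornerSign, Finset.prod_pow_eq_pow_sum]
        push_cast
        rfl
      have hb1 : ∀ j, b j - 1 + 1 = b j := fun j => Nat.sub_add_cancel (hb j).1
      simp only [hb1]
      rw [hs, mul_comm, mul_assoc, mul_comm (I : ℂ), ← mul_assoc, neg_mul,
        ← Finset.prod_mul_distrib]
      congr 2
      refine Finset.prod_congr rfl fun j _ => ?_
      rw [shift]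
      ring
    rw [Finset.sum_congr rfl fun a _ => hterm a, ← Finset.sum_mul, Finset.sum_neg_distrib,
      ← Fintype.prod_sum (fun j (x : Fin 2) => (-1 : ℂ) ^ (1 - (x : ℕ)) *
        (zetaRoot (M j) ^ ((α j : ℕ) + (x : ℕ)) * rootsNegOne M j) ^ b j * (1 / (M j : ℂ)))]
    have hprod : ∏ j, ∑ x : Fin 2, (-1 : ℂ) ^ (1 - (x : ℕ)) *
        (zetaRoot (M j) ^ ((α j : ℕ) + (x : ℕ)) * rootsNegOne M j) ^ b j * (1 / (M j : ℂ))
        = (∏ j, ((zetaRoot (M j) ^ b j - 1) * (rootsNegOne M j ^ b j * (1 / (M j : ℂ)))))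
          * ∏ j, zetaRoot (M j) ^ (b j * (α j : ℕ)) := by
      rw [← Finset.prod_mul_distrib]
      refine Finset.prod_congr rfl fun j _ => ?_
      simp only [Fin.sum_univ_two, Fin.val_zero, Fin.val_one]
      ring
    rw [hprod]
    ring

/-- Each slice of a vector in `𝒜` is annihilated by the characters with exponents `b` such
that the form with exponents `(b_1 - 1, …, b_n - 1, 0)` has weight less than `n / 2`. -/
lemma charSum_eq_zero_of_mem_spaceA {k : ℕ} {M : Fin (k + 1) → ℕ} (hM : ∀ i, 2 ≤ M i) {m : ℕ}
    {ν : IndexJ M × Fin (m - 1) → ℚ} (hν : ν ∈ spaceA M m) {b : Fin (k + 1) → ℕ}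
    (hb : ∀ i, 1 ≤ b i ∧ b i < M i)
    (hw : ∑ i, (b i : ℚ) / M i + 1 / m < ((k + 1 : ℕ) : ℚ) / 2) (l : Fin (m - 1)) :
    charSum M b (fun α => ν (α, l)) = 0 := by
  obtain ⟨C, hC, hper⟩ := exists_fermatPeriod_eq hM hb
  have h := hν (Fin.snoc (α := fun _ => ℕ) (fun i => b i - 1) 0) (by
    rw [weight]
    simp only [Fin.snoc_castSucc, Fin.snoc_last, Nat.cast_zero, zero_add]
    refine lt_of_eq_of_lt ?_ hw
    congr 1
    refine Finset.sum_congr rfl fun i _ => ?_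
    congr 1
    exact_mod_cast Nat.sub_add_cancel (hb i).1) (eulerResidue M fun i => b i - 1) (by
    simp only [Fin.snoc_castSucc]
    exact isResidue_eulerResidue hM _) l
  rw [Finset.sum_congr rfl fun α _ => by rw [hper α, mul_left_comm], ← Finset.mul_sum] at h
  rw [charSum_apply]
  exact (mul_eq_zero.1 h).resolve_left hC

/-! ### Dimension bounds -/

open IntermediateField in
/-- A character sum with values in `ℚ(ζ_T)` has a range of dimension at most `φ(T)`. -/
lemma finrank_range_charSum_le {k : ℕ} {M : Fin (k + 1) → ℕ} {b : Fin (k + 1) → ℕ} {T : ℕ}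
    (hT : 0 < T) (h : ∀ i, zetaRoot (M i) ^ b i ∈ ℚ⟮zetaRoot T⟯) :
    Module.finrank ℚ (LinearMap.range (charSum M b)) ≤ T.totient := by
  have hζ := zetaRoot_isPrimitiveRoot hT.ne'
  have hint : IsIntegral ℚ (zetaRoot T) := (hζ.isIntegral hT).tower_top
  have hfin : FiniteDimensional ℚ ℚ⟮zetaRoot T⟯ := adjoin.finiteDimensional hint
  have hle : LinearMap.range (charSum M b) ≤ Subalgebra.toSubmodule ℚ⟮zetaRoot T⟯.toSubalgebra := by
    rintro _ ⟨ν, rfl⟩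
    rw [charSum_apply, Subalgebra.mem_toSubmodule, IntermediateField.mem_toSubalgebra]
    refine sum_mem fun α _ => mul_mem (_root_.algebraMap_mem _ (ν α)) (_root_.prod_mem fun i _ => ?_)
    rw [pow_mul]
    exact pow_mem (h i) _
  calc Module.finrank ℚ (LinearMap.range (charSum M b))
      ≤ Module.finrank ℚ ℚ⟮zetaRoot T⟯ :=
        have : Module.Finite ℚ (Subalgebra.toSubmodule ℚ⟮zetaRoot T⟯.toSubalgebra) := hfin
        Submodule.finrank_mono hle
    _ = T.totient := by
        rw [adjoin.finrank hint, ← Polynomial.cyclotomic_eq_minpoly_rat hζ hT,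
          Polynomial.natDegree_cyclotomic]

/-- If finitely many character sums suffice to detect the slices of the vectors in `𝒜`, the
dimension of `𝒜` is bounded by `m - 1` times the total dimension of their ranges. -/
lemma rank_spaceA_le {k : ℕ} {M : Fin (k + 1) → ℕ} {m : ℕ} (S : Finset ℕ)
    (b : ℕ → Fin (k + 1) → ℕ) (N : ℕ → ℕ)
    (hN : ∀ d ∈ S, Module.finrank ℚ (LinearMap.range (charSum M (b d))) ≤ N d)
    (hinj : ∀ ν ∈ spaceA M m, ∀ l : Fin (m - 1),
      (∀ d ∈ S, charSum M (b d) (fun α => ν (α, l)) = 0) → ∀ α, ν (α, l) = 0) :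
    Module.rank ℚ (spaceA M m) ≤ (((m - 1) * ∑ d ∈ S, N d : ℕ) : Cardinal) := by
  let slice : Fin (m - 1) → (IndexJ M × Fin (m - 1) → ℚ) →ₗ[ℚ] (IndexJ M → ℚ) :=
    fun l => LinearMap.funLeft ℚ ℚ fun α => (α, l)
  let Φ : spaceA M m →ₗ[ℚ] ((x : Fin (m - 1) × S) → LinearMap.range (charSum M (b x.2))) :=
    LinearMap.pi fun x => (charSum M (b x.2)).rangeRestrict ∘ₗ slice x.1 ∘ₗ (spaceA M m).subtype
  have hΦ : Function.Injective Φ := by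
    rw [injective_iff_map_eq_zero]
    intro ν hν
    refine Subtype.ext (funext fun x => ?_)
    refine hinj ν.1 ν.2 x.2 (fun d hd => ?_) x.1
    exact congrArg Subtype.val (congrFun hν (x.2, ⟨d, hd⟩))
  rw [← Module.finrank_eq_rank, Nat.cast_le]
  refine (LinearMap.finrank_le_finrank_of_injective hΦ).trans ?_
  rw [Module.finrank_pi_fintype, Fintype.sum_prod_type]
  change ∑ _ : Fin (m - 1), ∑ d : S, Module.finrank ℚ (LinearMap.range (charSum M (b d))) ≤ _
  rw [Finset.sum_const, Finset.card_univ, Fintype.card_fin, smul_eq_mul]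
  refine Nat.mul_le_mul_left _ ?_
  rw [Finset.sum_coe_sort S fun d => Module.finrank ℚ (LinearMap.range (charSum M (b d)))]
  exact Finset.sum_le_sum hN

/-- The exponents `(1, …, 1, q / d)`, where `q` is the last `m_i`; the last coordinate of the
corresponding character is a primitive `d`-th root of unity. -/
def divisorExponent {r : ℕ} (q d : ℕ) : Fin (r + 2) → ℕ := Fin.snoc (α := fun _ => ℕ) 1 (q / d)

lemma divisorExponent_castSucc {r : ℕ} (q d : ℕ) (i : Fin (r + 1)) :
    divisorExponent q d i.castSucc = 1 := by
  simp [divisorExponent]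

lemma divisorExponent_last {r : ℕ} (q d : ℕ) :
    divisorExponent (r := r) q d (Fin.last (r + 1)) = q / d := by
  simp [divisorExponent]

/-- The dimension bound, provided that every character is a Galois conjugate of one with
exponents `(1, …, 1, q / d)`, and that those with `d > B` vanish on `𝒜`. -/
lemma rank_SHod_le {r : ℕ} {M : Fin (r + 2) → ℕ} (hM : ∀ i, 2 ≤ M i) {P : Polynomial ℂ}
    (D : JointSystem M P) {q : ℕ} (hq : q = M (Fin.last (r + 1))) (B : ℕ) (N : ℕ → ℕ)
    (hN : ∀ d ∈ q.divisors, Module.finrank ℚ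
      (LinearMap.range (charSum M (divisorExponent q d))) ≤ N d)
    (hB : ∀ d ∈ q.divisors, 2 ≤ d → B < d →
      ∑ i, (divisorExponent (r := r) q d i : ℚ) / M i + 1 / P.natDegree
        < ((r + 1 + 1 : ℕ) : ℚ) / 2)
    (hconj : ∀ b : Fin (r + 2) → ℕ, (∀ i, 1 ≤ b i ∧ b i < M i) → ∀ d a, d ∣ q →
      a.Coprime d → b (Fin.last (r + 1)) = a * (q / d) → ∃ c : ℕ, c.Coprime (∏ i, M i) ∧
        c ≡ a [MOD d] ∧ ∀ i : Fin (r + 1), c ≡ b i.castSucc [MOD M i.castSucc]) :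
    Module.rank ℚ (SHod hM D) ≤
      (((P.natDegree - 1) * ∑ d ∈ q.divisors with 2 ≤ d ∧ d ≤ B, N d : ℕ) : Cardinal) := by
  have hq2 : 2 ≤ q := hq ▸ hM _
  refine (rank_map_le _ _).trans (rank_spaceA_le _ (divisorExponent q) N
    (fun d hd => hN d (Finset.mem_filter.1 hd).1) fun ν hν l hdet => ?_)
  refine congrFun (eq_zero_of_charSum_eq_zero hM (fun α => ν (α, l)) fun b hb => ?_)
  -- The last coordinate of the character `b` is a root of unity of exact order `d = q / g`.
  set g := Nat.gcd (b (Fin.last (r + 1))) q with hg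
  have hgpos : 0 < g := Nat.gcd_pos_of_pos_right _ (by omega)
  have hgq : g ∣ q := Nat.gcd_dvd_right _ _
  have hgb : g ∣ b (Fin.last (r + 1)) := Nat.gcd_dvd_left _ _
  set d := q / g with hd
  have hqd : q / d = g := Nat.div_div_self hgq (by omega)
  have hdq : d ∣ q := Nat.div_dvd_of_dvd hgq
  have hdmem : d ∈ q.divisors := Nat.mem_divisors.2 ⟨hdq, by omega⟩
  have hlast := hb (Fin.last (r + 1))
  rw [← hq] at hlast
  have hglt : g < q := (Nat.le_of_dvd (by omega) hgb).trans_lt hlast.2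
  have hd2 : 2 ≤ d := by
    have h1 : d * g = q := Nat.div_mul_cancel hgq
    by_contra! h2
    interval_cases d <;> omega
  have hzero : charSum M (divisorExponent q d) (fun α => ν (α, l)) = 0 := by
    by_cases hdB : d ≤ B
    · exact hdet d (Finset.mem_filter.2 ⟨hdmem, hd2, hdB⟩)
    · refine charSum_eq_zero_of_mem_spaceA hM hν (fun i => ?_)
        (hB d hdmem hd2 (not_le.1 hdB)) l
      refine Fin.lastCases ?_ (fun i => ?_) i
      · rw [divisorExponent_last, hqd, ← hq]
        exact ⟨hgpos, hglt⟩
      · rw [divisorExponent_castSucc]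
        exact ⟨le_rfl, hM _⟩
  obtain ⟨c, hcL, hcd, hci⟩ := hconj b hb d (b (Fin.last (r + 1)) / g) hdq
    (by rw [Nat.coprime_comm, hd, hg, Nat.coprime_comm]
        exact Nat.coprime_div_gcd_div_gcd hgpos)
    (by rw [hqd, Nat.div_mul_cancel hgb])
  rw [← charSum_mul_eq_zero hM hzero hcL]
  refine charSum_congr hM (fun i => ?_) _
  refine Fin.lastCases ?_ (fun i => ?_) i
  · rw [divisorExponent_last, hqd, ← hq]
    have h1 := hcd.mul_right' (c := g)
    rw [Nat.div_mul_cancel hgb, hd, Nat.div_mul_cancel hgq] at h1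
    exact h1.symm
  · rw [divisorExponent_castSucc, mul_one]
    exact (hci i).symm

open IntermediateField in
lemma zetaRoot_two_pow_mem (e T : ℕ) : zetaRoot 2 ^ e ∈ ℚ⟮zetaRoot T⟯ := by
  have : zetaRoot 2 = -1 := (zetaRoot_isPrimitiveRoot two_ne_zero).eq_neg_one_of_two_right
  rw [this]
  exact pow_mem (neg_mem (one_mem _)) _

/-- The bound for exponents `(2, …, 2, q)`: all characters of the first coordinates are fixed by
Galois conjugation, and the character sums take values in `ℚ(ζ_d)`. -/
lemma rank_SHod_le_of_eq_two {r : ℕ} {M : Fin (r + 2) → ℕ} (hM : ∀ i, 2 ≤ M i)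
    {P : Polynomial ℂ} (D : JointSystem M P) {q : ℕ} (hq : q = M (Fin.last (r + 1)))
    (h2 : ∀ i, i ≠ Fin.last (r + 1) → M i = 2) (B : ℕ)
    (hB : ∀ d ∈ q.divisors, B < d → (1 : ℚ) / d + 1 / P.natDegree < 1 / 2) :
    Module.rank ℚ (SHod hM D) ≤
      (((P.natDegree - 1) * ∑ d ∈ q.divisors with 2 ≤ d ∧ d ≤ B, d.totient : ℕ) : Cardinal) := by
  have h2' : ∀ i : Fin (r + 1), M i.castSucc = 2 := fun i => h2 _ (Fin.castSucc_lt_last i).ne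
  have hq2 : 2 ≤ q := hq ▸ hM _
  refine rank_SHod_le hM D hq B _ (fun d hd => ?_) (fun d hd _ hdB => ?_)
    fun b hb d a hdq had _ => ?_
  · refine finrank_range_charSum_le (Nat.pos_of_mem_divisors hd) fun i => ?_
    refine Fin.lastCases ?_ (fun i => ?_) i
    · rw [divisorExponent_last, ← hq, zetaRoot_pow_div (by omega) (Nat.dvd_of_mem_divisors hd)]
      exact IntermediateField.mem_adjoin_simple_self ℚ _
    · rw [h2']
      exact zetaRoot_two_pow_mem _ _
  · have hd0 : (d : ℚ) ≠ 0 := by exact_mod_cast (Nat.pos_of_mem_divisors hd).ne'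
    have hq0 : (q : ℚ) ≠ 0 := by exact_mod_cast (by omega : q ≠ 0)
    have hqd : ((q / d : ℕ) : ℚ) / q = 1 / d := by
      rw [Nat.cast_div (Nat.dvd_of_mem_divisors hd) hd0]
      field_simp
    rw [Fin.sum_univ_castSucc]
    simp only [divisorExponent_castSucc, divisorExponent_last, h2', ← hq, hqd, Finset.sum_const,
      Finset.card_univ, Fintype.card_fin, nsmul_eq_mul]
    push_cast
    linarith [hB d hd hdB]
  · have hqL : q ∣ ∏ i, M i := hq ▸ Finset.dvd_prod_of_mem M (Finset.mem_univ _)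
    obtain ⟨c, hc, hcL⟩ := exists_modEq_coprime
      (Finset.prod_ne_zero_iff.2 fun i _ => (by have := hM i; omega)) (hdq.trans hqL) had
    refine ⟨c, hcL, hc, fun i => ?_⟩
    have hbi := hb i.castSucc
    have hc2 : c.Coprime (M i.castSucc) :=
      hcL.coprime_dvd_right (Finset.dvd_prod_of_mem M (Finset.mem_univ _))
    rw [h2'] at hbi hc2 ⊢
    have hb1 : b i.castSucc = 1 := by omega
    rw [hb1]
    exact Nat.odd_iff.1 (Nat.coprime_two_right.1 hc2)

/-- The bound for exponents `(2, …, 2, p, q)` with `p` prime and prime to `q`: Galois conjugation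
acts independently on the last two coordinates, and the character sums take values in
`ℚ(ζ_{pd})`. -/
lemma rank_SHod_le_of_prime {r : ℕ} {M : Fin (r + 2) → ℕ} (hM : ∀ i, 2 ≤ M i)
    {P : Polynomial ℂ} (D : JointSystem M P) {p q : ℕ} (hp : p = M (Fin.last r).castSucc)
    (hq : q = M (Fin.last (r + 1)))
    (h2 : ∀ i, i ≠ Fin.last (r + 1) → i ≠ (Fin.last r).castSucc → M i = 2) (hprime : p.Prime)
    (hpq : p.Coprime q) (B : ℕ)
    (hB : ∀ d ∈ q.divisors, B < d → (1 : ℚ) / p + 1 / d + 1 / P.natDegree < 1) :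
    Module.rank ℚ (SHod hM D) ≤
      (((P.natDegree - 1) * (p - 1) * ∑ d ∈ q.divisors with 2 ≤ d ∧ d ≤ B, d.totient : ℕ) :
        Cardinal) := by
  have h2' : ∀ i : Fin r, M i.castSucc.castSucc = 2 := fun i =>
    h2 _ (Fin.castSucc_lt_last _).ne fun h =>
      (Fin.castSucc_lt_last i).ne (Fin.castSucc_injective _ h)
  have hq2 : 2 ≤ q := hq ▸ hM _
  rw [mul_assoc, Finset.mul_sum]
  refine rank_SHod_le hM D hq B _ (fun d hd => ?_) (fun d hd _ hdB => ?_)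
    fun b hb d a hdq had _ => ?_
  · have hpd : p.Coprime d := hpq.coprime_dvd_right (Nat.dvd_of_mem_divisors hd)
    have hd0 := Nat.pos_of_mem_divisors hd
    have hpd0 : 0 < p * d := Nat.mul_pos hprime.pos hd0
    rw [← Nat.totient_prime hprime, ← Nat.totient_mul hpd]
    refine finrank_range_charSum_le hpd0 fun i => ?_
    have hmem : ∀ e, e ∣ p * d → zetaRoot e ∈ IntermediateField.adjoin ℚ {zetaRoot (p * d)} :=
      fun e he => by
        rw [← zetaRoot_pow_div hpd0.ne' he]
        exact pow_mem (IntermediateField.mem_adjoin_simple_self ℚ _) _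
    refine Fin.lastCases ?_ (fun i => Fin.lastCases ?_ (fun i => ?_) i) i
    · rw [divisorExponent_last, ← hq, zetaRoot_pow_div (by omega) (Nat.dvd_of_mem_divisors hd)]
      exact hmem d (Nat.dvd_mul_left _ _)
    · rw [divisorExponent_castSucc, ← hp, pow_one]
      exact hmem p (Nat.dvd_mul_right _ _)
    · rw [h2']
      exact zetaRoot_two_pow_mem _ _
  · have hd0 : (d : ℚ) ≠ 0 := by exact_mod_cast (Nat.pos_of_mem_divisors hd).ne'
    have hq0 : (q : ℚ) ≠ 0 := by exact_mod_cast (by omega : q ≠ 0)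
    have hqd : ((q / d : ℕ) : ℚ) / q = 1 / d := by
      rw [Nat.cast_div (Nat.dvd_of_mem_divisors hd) hd0]
      field_simp
    rw [Fin.sum_univ_castSucc, Fin.sum_univ_castSucc]
    simp only [divisorExponent_castSucc, divisorExponent_last, h2', ← hq, ← hp, hqd,
      Finset.sum_const, Finset.card_univ, Fintype.card_fin, nsmul_eq_mul]
    push_cast
    linarith [hB d hd hdB]
  · have hpd : p.Coprime d := hpq.coprime_dvd_right hdq
    have hqL : q ∣ ∏ i, M i := hq ▸ Finset.dvd_prod_of_mem M (Finset.mem_univ _)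
    have hpL : p ∣ ∏ i, M i := hp ▸ Finset.dvd_prod_of_mem M (Finset.mem_univ _)
    have hbp := hb (Fin.last r).castSucc
    rw [← hp] at hbp
    obtain ⟨s, hsp, hsd⟩ := Nat.chineseRemainder hpd (b (Fin.last r).castSucc) a
    have hs : s.Coprime (p * d) := by
      refine Nat.Coprime.mul_right ?_ ?_
      · rw [Nat.Coprime, hsp.gcd_eq]
        exact (Nat.coprime_of_lt_prime (by omega) hbp.2 hprime).symm
      · rw [Nat.Coprime, hsd.gcd_eq]
        exact had
    obtain ⟨c, hc, hcL⟩ := exists_modEq_coprime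
      (Finset.prod_ne_zero_iff.2 fun i _ => (by have := hM i; omega))
      (hpd.mul_dvd_of_dvd_of_dvd hpL (hdq.trans hqL)) hs
    refine ⟨c, hcL, (hc.of_mul_left p).trans hsd, fun i => ?_⟩
    refine Fin.lastCases ?_ (fun i => ?_) i
    · rw [← hp]
      exact (hc.of_mul_right d).trans hsp
    · have hbi := hb i.castSucc.castSucc
      have hc2 : c.Coprime (M i.castSucc.castSucc) :=
        hcL.coprime_dvd_right (Finset.dvd_prod_of_mem M (Finset.mem_univ _))
      rw [h2'] at hbi hc2 ⊢
      have hb1 : b i.castSucc.castSucc = 1 := by omega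
      rw [hb1]
      exact Nat.odd_iff.1 (Nat.coprime_two_right.1 hc2)

lemma sum_totient_divisors_two_le {q : ℕ} (hq : 2 ≤ q) :
    ∑ d ∈ q.divisors with 2 ≤ d ∧ d ≤ q, d.totient = q - 1 := by
  have h := Nat.sum_totient q
  have h1 : 1 ∈ q.divisors := Nat.one_mem_divisors.2 (by omega)
  rw [← Finset.add_sum_erase _ _ h1, Nat.totient_one] at h
  have hset : {d ∈ q.divisors | 2 ≤ d ∧ d ≤ q} = q.divisors.erase 1 := by
    ext d
    simp only [Finset.mem_filter, Finset.mem_erase]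
    constructor
    · rintro ⟨hd, hd2, -⟩
      exact ⟨by omega, hd⟩
    · rintro ⟨hd1, hd⟩
      have := Nat.pos_of_mem_divisors hd
      exact ⟨hd, by omega, Nat.divisor_le hd⟩
  rw [hset]
  omega

end HodgeJoin

/-! ### The bounds for strong generic Hodge cycles -/

theorem mainTheorem2 {r : ℕ} (hr : Even (r + 2)) (M : Fin (r + 2) → ℕ) (hM : ∀ i, 2 ≤ M i)
    (P : Polynomial ℂ) (m : ℕ) (hm : 2 ≤ m) (hdeg : P.natDegree = m) (hdisc : P.discr ≠ 0)
    (D : HodgeJoin.JointSystem M P) (p q : ℕ)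
    -- `p = m_{n-1}` and `q = m_n`, where `n = r + 2`
    (hp : p = M (Fin.last r).castSucc) (hq : q = M (Fin.last (r + 1))) :
    -- (i)
    ((∀ i, i ≠ Fin.last (r + 1) → M i = 2) →
      (3 ≤ m → m ≤ 6 →
        Module.rank ℚ (HodgeJoin.SHod hM D) ≤
          (((m - 1) * ∑ d ∈ q.divisors with 2 ≤ d ∧ d ≤ ⌊(2 * m : ℚ) / ((m : ℚ) - 2)⌋₊,
            d.totient : ℕ) : Cardinal)) ∧
      (m = 2 →
        Module.rank ℚ (HodgeJoin.SHod hM D) ≤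
          (((m - 1) * ∑ d ∈ q.divisors with 2 ≤ d ∧ d ≤ q, d.totient : ℕ) : Cardinal) ∧
        Module.rank ℚ (HodgeJoin.SHod hM D) ≤ ((q - 1 : ℕ) : Cardinal))) ∧
    -- (ii)
    ((∀ i, i ≠ Fin.last (r + 1) → i ≠ (Fin.last r).castSucc → M i = 2) →
      p.Prime → Nat.gcd p q = 1 → (1 : ℚ) / 2 ≤ 1 / (p : ℚ) + 1 / (m : ℚ) →
      (¬(m = 2 ∧ p = 2) →
        Module.rank ℚ (HodgeJoin.SHod hM D) ≤
          (((m - 1) * (p - 1) * ∑ d ∈ q.divisors with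
            2 ≤ d ∧ d ≤ ⌊(m * p : ℚ) / ((m : ℚ) * p - m - p)⌋₊, d.totient : ℕ) : Cardinal)) ∧
      (m = 2 ∧ p = 2 →
        Module.rank ℚ (HodgeJoin.SHod hM D) ≤
          (((m - 1) * (p - 1) * ∑ d ∈ q.divisors with 2 ≤ d ∧ d ≤ q, d.totient : ℕ) :
            Cardinal))) := by
  subst hdeg
  have hM2 : 2 ≤ q := hq ▸ hM _
  have hm0 : (0 : ℚ) < P.natDegree := by exact_mod_cast (by omega : 0 < P.natDegree)
  refine ⟨fun h2 => ⟨fun h3 _ => ?_, fun hm2 => ?_⟩, fun h2 hprime hpq _ => ⟨fun hne => ?_, ?_⟩⟩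
  · refine HodgeJoin.rank_SHod_le_of_eq_two hM D hq h2 _ fun d hd hBd => ?_
    have hd0 : (0 : ℚ) < d := by exact_mod_cast Nat.pos_of_mem_divisors hd
    have h3' : (3 : ℚ) ≤ P.natDegree := by exact_mod_cast h3
    -- `d > 2 m / (m - 2)` is the inequality `1 / d + 1 / m < 1 / 2`
    rw [Nat.floor_lt (div_nonneg (by positivity) (by linarith)), div_lt_iff₀ (by linarith)] at hBd
    rw [div_add_div _ _ hd0.ne' hm0.ne', div_lt_div_iff₀ (by positivity) two_pos]
    linarith
  · have h := HodgeJoin.rank_SHod_le_of_eq_two hM D hq h2 q fun d hd hqd =>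
      absurd (Nat.divisor_le hd) (not_le.2 hqd)
    refine ⟨h, h.trans_eq ?_⟩
    rw [HodgeJoin.sum_totient_divisors_two_le hM2, hm2]
    norm_num
  · refine HodgeJoin.rank_SHod_le_of_prime hM D hp hq h2 hprime hpq _ fun d hd hBd => ?_
    have hd0 : (0 : ℚ) < d := by exact_mod_cast Nat.pos_of_mem_divisors hd
    have hp0 : (0 : ℚ) < p := by exact_mod_cast hprime.pos
    -- `m p - m - p = (m - 1) (p - 1) - 1` is positive unless `m = p = 2`
    have hpos : (0 : ℚ) < (P.natDegree : ℚ) * p - P.natDegree - p := by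
      have hp2 := hprime.two_le
      have : P.natDegree + p < P.natDegree * p := by
        rcases Nat.lt_or_ge 2 P.natDegree with h | h
        · nlinarith
        · have hm2 : P.natDegree = 2 := by omega
          rw [hm2] at hne ⊢
          omega
      have : ((P.natDegree + p : ℕ) : ℚ) < (P.natDegree * p : ℕ) := by exact_mod_cast this
      push_cast at this
      linarith
    -- `d > m p / (m p - m - p)` is the inequality `1 / p + 1 / d + 1 / m < 1`
    rw [Nat.floor_lt (div_nonneg (by positivity) hpos.le), div_lt_iff₀ hpos] at hBd
    rw [div_add_div _ _ hp0.ne' hd0.ne', div_add_div _ _ (by positivity) hm0.ne',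
      div_lt_one (by positivity)]
    linarith
  · rintro -
    exact HodgeJoin.rank_SHod_le_of_prime hM D hp hq h2 hprime hpq q fun d hd hqd =>
      absurd (Nat.divisor_le hd) (not_le.2 hqd)
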